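/- \textbf{The game (Model B2).} Let $d\ge 1$ be an integer. Cards are dealt without replacement from a well-shuffled shoe of $d$ standard 52-card decks; A, 2–9 have values $1,2,\dots,9$ and 10, J, Q, K have value $0$. The total of a hand is the sum of its card values modulo $10$. Player and Banker receive two cards each. If either two-card total is $8$ or $9$, the game ends. Otherwise Player may draw a third card, which is dealt face up: he must draw on a two-card total of at most $4$, must stand on $6$ or $7$, and is free to choose on $5$. Then Banker, knowing the composition of his own two-card hand $(j_1,j_2)$, $j_1\le j_2$ (values), and Player's third card $k\in\{0,\dots,9\}$ ($k=\varnothing$ if Player stood), may draw a third card or stand, without restriction. The higher final total wins; Player's profit is $+1$, $-1$ or $0$ (tie). Player sees only his own two-card total, so he has two pure strategies (draw or stand on $5$). A pure strategy of Banker is a set of triples $(j_1,j_2,k)$ on which he draws, with $0\le j_1\le j_2\le 9$, $(j_1+j_2)\bmod 10\le 7$ and $k\in\{0,\dots,9,\varnothing\}$, so he has $2^{484}$ pure strategies. The payoff matrix consists of Player's expected profits; mixed strategies are probability distributions on pure strategies. \textbf{Theorem.} For every integer $d\ge1$ the following mixed strategies of Player and Banker are uniquely optimal in this $2\times 2^{484}$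 matrix game: each is the only optimal (maximin, respectively minimax) mixed strategy of the respective player. Player draws on a two-card total of $5$ with probability $$p_d=\frac{(8d-1)(12d-1)(24d-1)}{2d(1408d^2-220d+9)}.$$ Banker draws on $(0,6)$, when Player stands, with probability $q_d\in(0,1)$, where $$q_1=\tfrac{290383}{450072},\quad q_2=\tfrac{2591845}{4119192},\quad q_3=\tfrac{9294089}{14521368},$$ $$q_d=\frac{368640d^4-68624d^3-2168d^2+981d-48}{8d(52d-5)(1408d^2-220d+9)}\quad(4\le d\le7),$$ $$q_d=\frac{367616d^4-67728d^3-2416d^2+1015d-51}{8d(52d-5)(1408d^2-220d+9)}\quad(d=8,9),$$ $$q_d=\frac{366592d^4-67344d^3-2456d^2+1017d-51}{8d(52d-5)(1408d^2-220d+9)}\quad(d\ge10).$$ In every other case Banker plays deterministically, according to his two-card total $j=(j_1+j_2)\bmod 10$ and $k$: - $j\in\{0,1,2\}$: draw. - $j=3$: draw, except that he stands if $k=8$, unless $(j_1,j_2)=(4,9)$ and $d=1$ (then he draws). - $j=4$: draw if $k\in\{2,\dots,7,\varnothing\}$; stand if $k\in\{0,8,9\}$; if $k=1$, draw on $(6,8)$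 and $(7,7)$ when $d\le 2$, and stand otherwise. - $j=5$: draw if $k\in\{5,6,7,\varnothing\}$; stand if $k\in\{0,1,2,3,8,9\}$; if $k=4$, draw on $(0,5)$ and $(7,8)$ iff $d\ge2$, on $(1,4)$ iff $d\ge8$, on $(2,3)$ iff $d\ge10$, and on $(6,9)$ iff $d\ge3$. - $j=6$: draw if $k=7$; stand if $k\in\{0,\dots,5,8,9\}$; if $k=6$, draw, except that he stands on $(3,3)$ when $d\le3$; if $k=\varnothing$, draw on $(8,8)$, stand on $(1,5),(2,4),(3,3),(7,9)$, and mix as above on $(0,6)$. - $j=7$: stand. (Thus Banker mixes, with probabilities $1-q_d$ and $q_d$, the two pure strategies that follow this list and stand, respectively draw, on $(0,6)$ when Player stands.) The value of the game to Player is $$v_1=-\tfrac{22932137}{1666583100},\quad v_2=-\tfrac{8220886553}{620866384425},\quad v_3=-\tfrac{210084639838}{16053072820785},$$ and, with $(52d)_6=52d(52d-1)\cdots(52d-5)$ and $D_d=(1408d^2-220d+9)\,(52d)_6$, $v_d=-32d\,N_d/D_d$ for $d\ge 4$, where $$\begin{aligned} N_d={}&11125325824d^7-4182669312d^6+615333888d^5-43467904d^4\\&+1329008d^3+5040d^2-1551d+39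 &&(4\le d\le 7),\\ N_d={}&11129683968d^7-4218739712d^6+635681024d^5-47725760d^4\\&+1738944d^3-14344d^2-1093d+33 &&(d=8,9),\\ N_d={}&11134042112d^7-4259389440d^6+648152320d^5-49007232d^4\\&+1788256d^3-14816d^2-1089d+33 &&(d\ge 10). \end{aligned}$$ -/

import Mathlib

/-! ### Matrix games and mixed strategies -/

/-- Expected payoff to player I in the matrix game `A` when player I uses the mixed strategy `x` and
player II uses the mixed strategy `y`. -/
noncomputable def expectedPayoff {I J : Type*} [Fintype I] [Fintype J]
    (A : I → J → ℝ) (x : I → ℝ) (y : J → ℝ) : ℝ :=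
  ∑ i, ∑ j, x i * A i j * y j

/-- `x` secures player I an expected payoff of at least `w`. -/
def GuaranteesI {I J : Type*} [Fintype I] [Fintype J]
    (A : I → J → ℝ) (x : I → ℝ) (w : ℝ) : Prop :=
  ∀ y ∈ stdSimplex ℝ J, w ≤ expectedPayoff A x y

/-- `y` holds player I to an expected payoff of at most `w`. -/
def GuaranteesII {I J : Type*} [Fintype I] [Fintype J]
    (A : I → J → ℝ) (y : J → ℝ) (w : ℝ) : Prop :=
  ∀ x ∈ stdSimplex ℝ I, expectedPayoff A x y ≤ w

/-- `x` is an optimal (maximin) mixed strategy of player I: whatever some mixed strategy guarantees,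
`x` guarantees as well. -/
def IsOptimalI {I J : Type*} [Fintype I] [Fintype J]
    (A : I → J → ℝ) (x : I → ℝ) : Prop :=
  x ∈ stdSimplex ℝ I ∧
    ∀ x' ∈ stdSimplex ℝ I, ∀ w : ℝ, GuaranteesI A x' w → GuaranteesI A x w

/-- `y` is an optimal (minimax) mixed strategy of player II. -/
def IsOptimalII {I J : Type*} [Fintype I] [Fintype J]
    (A : I → J → ℝ) (y : J → ℝ) : Prop :=
  y ∈ stdSimplex ℝ J ∧
    ∀ y' ∈ stdSimplex ℝ J, ∀ w : ℝ, GuaranteesII A y' w → GuaranteesII A y w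

/-- `v` is the value (to player I) of the matrix game `A`. -/
def IsGameValue {I J : Type*} [Fintype I] [Fintype J] (A : I → J → ℝ) (v : ℝ) : Prop :=
  (∃ x ∈ stdSimplex ℝ I, GuaranteesI A x v) ∧ (∃ y ∈ stdSimplex ℝ J, GuaranteesII A y v)

/-! ### Baccara, dealt without replacement from a `d`-deck shoe.

Card values are elements of `Fin 10`; addition in `Fin 10` is addition modulo 10, so the total of a
hand is the sum of its card values in `Fin 10`. -/

/-- A shoe, given by the number of remaining cards of each value. -/
abbrev Shoe := Fin 10 → ℕ

/-- `d` decks of 52 cards: 10, J, Q, K have value 0. -/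
def fullShoe (d : ℕ) : Shoe := fun r => if r = 0 then 16 * d else 4 * d

/-- Expectation, over a card drawn uniformly at random from the shoe `s`, of a function of the value
of that card and of the shoe that remains. -/
noncomputable def drawCard (s : Shoe) (f : Fin 10 → Shoe → ℝ) : ℝ :=
  ∑ r, ((s r : ℝ) / ((∑ i, s i : ℕ) : ℝ)) * f r (Function.update s r (s r - 1))

/-- Player's profit from a one-unit bet when the final totals of Player and Banker are `x`, `y`. -/
def profit (x y : Fin 10) : ℝ := if y < x then 1 else if x < y then -1 else 0

/-- Non-natural two-card hands of Banker (the smaller value first). -/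
abbrev BankerHand := {h : Fin 10 × Fin 10 // h.1 ≤ h.2 ∧ h.1 + h.2 ≤ 7}

/-- What Banker knows when he acts: the composition of his own two-card hand and the value of
Player's third card, `none` if Player stands. -/
abbrev BankerInfo := BankerHand × Option (Fin 10)

/-- The hand consisting of two cards, given in any order. -/
def bankerHand (y₁ y₂ : Fin 10) (h : y₁ + y₂ ≤ 7) : BankerHand :=
  ⟨(min y₁ y₂, max y₁ y₂), min_le_max, by rw [min_add_max]; exact h⟩

/-- Player's total `x` is at most 7. He must draw on 4 or less and stand on 6 or 7; his pure strategy
`u` says whether he draws on 5. -/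
def PlayerDraws (u : Bool) (x : Fin 10) : Prop := x < 5 ∨ (x = 5 ∧ u = true)

instance (u : Bool) (x : Fin 10) : Decidable (PlayerDraws u x) := by
  unfold PlayerDraws; infer_instance

/-- Player's expected profit once Player has completed his hand with total `x`. Banker's pure strategy
is the set `T` of information states in which he draws. -/
noncomputable def bankerTurn (T : Finset BankerInfo) (s : Shoe) (x : Fin 10)
    (h : BankerHand) (k : Option (Fin 10)) : ℝ :=
  if (h, k) ∈ T then drawCard s fun c _ => profit x (h.1.1 + h.1.2 + c)
  else profit x (h.1.1 + h.1.2)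

/-- Player's expected profit when neither hand is a natural and Player, with two-card total `x`, is
about to act. -/
noncomputable def playerTurn (u : Bool) (T : Finset BankerInfo) (s : Shoe) (x : Fin 10)
    (h : BankerHand) : ℝ :=
  if PlayerDraws u x then drawCard s fun c s' => bankerTurn T s' (x + c) h (some c)
  else bankerTurn T s x h none

/-- The payoff matrix, of size `2 × 2 ^ 484`: Player's expected profit from a one-unit bet. -/
noncomputable def baccaraPayoff (d : ℕ) (u : Bool) (T : Finset BankerInfo) : ℝ :=
  drawCard (fullShoe d) fun x₁ s₁ => drawCard s₁ fun x₂ s₂ =>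
    drawCard s₂ fun y₁ s₃ => drawCard s₃ fun y₂ s₄ =>
      if h : x₁ + x₂ ≤ 7 ∧ y₁ + y₂ ≤ 7 then
        playerTurn u T s₄ (x₁ + x₂) (bankerHand y₁ y₂ h.2)
      else profit (x₁ + x₂) (y₁ + y₂)

/-! ### The strategies and the value -/

/-- Draw on a two-card total of 5 with probability `p`. -/
def playerMix (p : ℝ) : Bool → ℝ := fun u => if u = true then p else 1 - p

/-- The table of Banker's moves with `d` decks, for the two-card hand `j` and Player's third card `k`:
`true` means draw. The one entry at which Banker mixes, `j = (0, 6)` and `k = none`, is listed here as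
"stand". -/
def tableDraws (d : ℕ) (j : Fin 10 × Fin 10) (k : Option (Fin 10)) : Bool :=
  if j.1 + j.2 ≤ 2 then true
  else if j.1 + j.2 = 3 then
    if k = some 8 then decide (j = (4, 9) ∧ d = 1) else true
  else if j.1 + j.2 = 4 then
    if k = some 1 then decide (j ∈ [(6, 8), (7, 7)] ∧ d ≤ 2)
    else decide (k ∈ [some 2, some 3, some 4, some 5, some 6, some 7, none])
  else if j.1 + j.2 = 5 then
    if k = some 4 then
      decide (j ∈ [(0, 5), (7, 8)] ∧ 2 ≤ d) || decide (j = (1, 4) ∧ 8 ≤ d) ||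
        decide (j = (2, 3) ∧ 10 ≤ d) || decide (j = (6, 9) ∧ 3 ≤ d)
    else decide (k ∈ [some 5, some 6, some 7, none])
  else if j.1 + j.2 = 6 then
    if k = some 6 then
      decide (j ∈ [(0, 6), (1, 5), (2, 4), (7, 9), (8, 8)]) || decide (j = (3, 3) ∧ 4 ≤ d)
    else if k = none then decide (j = (8, 8))
    else decide (k = some 7)
  else false

/-- Banker's pure strategy that follows the table and stands on `(0, 6)` when Player stands. -/
def bankerS (d : ℕ) : Finset BankerInfo :=
  Finset.univ.filter fun i => tableDraws d i.1.1 i.2 = true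

/-- Banker's pure strategy that follows the table and draws on `(0, 6)` when Player stands. -/
def bankerD (d : ℕ) : Finset BankerInfo :=
  insert (⟨(0, 6), by decide⟩, none) (bankerS d)

/-- Follow the table, and on `(0, 6)`, when Player stands, draw with probability `q`. -/
noncomputable def bankerMix (d : ℕ) (q : ℝ) : Finset BankerInfo → ℝ :=
  (1 - q) • Pi.single (bankerS d) 1 + q • Pi.single (bankerD d) 1

/-- Player's probability of drawing on a two-card total of 5. -/
noncomputable def pOpt (n : ℕ) : ℝ :=
  let d : ℝ := n
  (8 * d - 1) * (12 * d - 1) * (24 * d - 1) / (2 * d * (1408 * d ^ 2 - 220 * d + 9))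

/-- Banker's probability of drawing on `(0, 6)` when Player stands. -/
noncomputable def qOpt (n : ℕ) : ℝ :=
  let d : ℝ := n
  if n = 1 then 290383 / 450072
  else if n = 2 then 2591845 / 4119192
  else if n = 3 then 9294089 / 14521368
  else if n ≤ 7 then
    (368640 * d ^ 4 - 68624 * d ^ 3 - 2168 * d ^ 2 + 981 * d - 48) /
      (8 * d * (52 * d - 5) * (1408 * d ^ 2 - 220 * d + 9))
  else if n ≤ 9 then
    (367616 * d ^ 4 - 67728 * d ^ 3 - 2416 * d ^ 2 + 1015 * d - 51) /
      (8 * d * (52 * d - 5) * (1408 * d ^ 2 - 220 * d + 9))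
  else
    (366592 * d ^ 4 - 67344 * d ^ 3 - 2456 * d ^ 2 + 1017 * d - 51) /
      (8 * d * (52 * d - 5) * (1408 * d ^ 2 - 220 * d + 9))

/-- The value of the game to Player; `(52 * n).descFactorial 6` is
`52n (52n - 1) ⋯ (52n - 5)`. -/
noncomputable def vOpt (n : ℕ) : ℝ :=
  let d : ℝ := n
  let D : ℝ := (1408 * d ^ 2 - 220 * d + 9) * ((52 * n).descFactorial 6 : ℝ)
  if n = 1 then -(22932137 / 1666583100)
  else if n = 2 then -(8220886553 / 620866384425)
  else if n = 3 then -(210084639838 / 16053072820785)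
  else if n ≤ 7 then
    -(32 * d * (11125325824 * d ^ 7 - 4182669312 * d ^ 6 + 615333888 * d ^ 5 - 43467904 * d ^ 4
      + 1329008 * d ^ 3 + 5040 * d ^ 2 - 1551 * d + 39) / D)
  else if n ≤ 9 then
    -(32 * d * (11129683968 * d ^ 7 - 4218739712 * d ^ 6 + 635681024 * d ^ 5 - 47725760 * d ^ 4
      + 1738944 * d ^ 3 - 14344 * d ^ 2 - 1093 * d + 33) / D)
  else
    -(32 * d * (11134042112 * d ^ 7 - 4259389440 * d ^ 6 + 648152320 * d ^ 5 - 49007232 * d ^ 4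
      + 1788256 * d ^ 3 - 14816 * d ^ 2 - 1089 * d + 33) / D)

/-! Banker's pure strategy is a set of information states, and the payoff is a sum of contributions,
one for each of the 484 states, each depending only on Banker's move there (`baccaraPayoff_eq`).
Hence against a fixed mixture of Player the best replies are found state by state, and are unique
except where drawing and standing contribute the same (`sum_lt_sum_of_ne`).

The probability `pOpt d` is the one that makes Banker indifferent on (0,6) when Player stands
(`mixedContribution_mixedInfo`). At every other state the difference between drawing and standing is
nonzero, with the sign that the table records (`mixedContribution_sign`), so `bankerS d` and
`bankerD d` are the only best replies. The probability `qOpt d` makes Player indifferent between his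
two moves on 5, the common payoff being `vOpt d` (`equalizer`). Two equalizing mixtures with
interior probabilities, strictness in all other columns and a nondegenerate 2 × 2 kernel give the
value and both uniqueness statements (`unique_optimal_of_equalizers`).

The signs must be found for all d at once. After multiplication by the number `sixDeals d` of
ordered six-card deals, all contributions are polynomials in d. Written in e = d - 1 ≥ 0, the
differences have coefficients of one sign at all but ten states. One of these is (0,6), and at the
other nine Banker's move depends on d; they are treated separately. -/

/-! ### Weights of ordered deals -/

/-- The shoe of `d` decks after the cards of `l` have been removed. -/
def removed (d : ℕ) (l : List (Fin 10)) : Shoe := fun r => fullShoe d r - l.count r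

/-- The number of ways to deal the cards of `l`, in this order, from a shoe of `d` decks. -/
def dealWeight (d : ℕ) (l : List (Fin 10)) : ℕ :=
  ∏ r, (fullShoe d r).descFactorial (l.count r)

/-- The number of cards of value `r` left after the cards of `l` have been removed, as a real number
(negative if `l` has too many such cards). -/
noncomputable def cardsLeft (d : ℕ) (l : List (Fin 10)) (r : Fin 10) : ℝ :=
  (fullShoe d r : ℝ) - (l.count r : ℝ)

theorem removed_nil (d : ℕ) : removed d [] = fullShoe d := by
  funext r; simp [removed]

theorem dealWeight_nil (d : ℕ) : dealWeight d [] = 1 := by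
  simp [dealWeight]

theorem update_removed (d : ℕ) (l : List (Fin 10)) (r : Fin 10) :
    Function.update (removed d l) r (removed d l r - 1) = removed d (r :: l) := by
  funext t
  by_cases h : t = r
  · subst h; simp [removed, Nat.sub_sub]
  · simp [removed, Function.update_of_ne h, List.count_cons_of_ne (Ne.symm h)]

theorem dealWeight_cons (d : ℕ) (l : List (Fin 10)) (r : Fin 10) :
    dealWeight d (r :: l) = dealWeight d l * removed d l r := by
  unfold dealWeight removed
  rw [← Finset.mul_prod_erase _ _ (Finset.mem_univ r),
    ← Finset.mul_prod_erase _ (fun t => (fullShoe d t).descFactorial (l.count t))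
      (Finset.mem_univ r),
    List.count_cons_self, Nat.descFactorial_succ]
  have : ∏ x ∈ Finset.univ.erase r, (fullShoe d x).descFactorial ((r :: l).count x) =
      ∏ x ∈ Finset.univ.erase r, (fullShoe d x).descFactorial (l.count x) := by
    refine Finset.prod_congr rfl fun x hx => ?_
    rw [List.count_cons_of_ne (Finset.ne_of_mem_erase hx).symm]
  rw [this]; ring

theorem dealWeight_perm {d : ℕ} {l l' : List (Fin 10)} (h : l.Perm l') :
    dealWeight d l = dealWeight d l' := by
  unfold dealWeight
  exact Finset.prod_congr rfl fun r _ => by rw [h.count_eq]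

theorem cardsLeft_perm {d : ℕ} {l l' : List (Fin 10)} (h : l.Perm l') :
    cardsLeft d l = cardsLeft d l' := by
  funext r; rw [cardsLeft, cardsLeft, h.count_eq]

theorem count_le_of_dealWeight_ne_zero {d : ℕ} {l : List (Fin 10)} (h : dealWeight d l ≠ 0)
    (r : Fin 10) : l.count r ≤ fullShoe d r := by
  by_contra hr
  refine h (Finset.prod_eq_zero (Finset.mem_univ r) ?_)
  exact Nat.descFactorial_eq_zero_iff_lt.2 (not_le.1 hr)

theorem cast_removed {d : ℕ} {l : List (Fin 10)} (h : dealWeight d l ≠ 0) (r : Fin 10) :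
    (removed d l r : ℝ) = cardsLeft d l r := by
  rw [removed, cardsLeft, Nat.cast_sub (count_le_of_dealWeight_ne_zero h r)]

/-- If `l` cannot be dealt, both sides vanish. This is what permits the untruncated `cardsLeft`,
which is affine in d, in place of the truncated counts of an actual shoe. -/
theorem cast_dealWeight_cons (d : ℕ) (l : List (Fin 10)) (r : Fin 10) :
    (dealWeight d (r :: l) : ℝ) = dealWeight d l * cardsLeft d l r := by
  rw [dealWeight_cons, Nat.cast_mul]
  by_cases h : dealWeight d l = 0
  · simp [h]
  · rw [cast_removed h]

theorem sum_count (l : List (Fin 10)) : ∑ r, l.count r = l.length := by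
  induction l with
  | nil => simp
  | cons a l ih =>
    simp only [List.count_cons, Finset.sum_add_distrib, ih, List.length_cons]
    simp

theorem sum_fullShoe (d : ℕ) : ∑ r, fullShoe d r = 52 * d := by
  simp [fullShoe, Fin.sum_univ_succ]; ring

theorem sum_cardsLeft (d : ℕ) (l : List (Fin 10)) : ∑ r, cardsLeft d l r = 52 * d - l.length := by
  simp only [cardsLeft, Finset.sum_sub_distrib]
  rw [← Nat.cast_sum, ← Nat.cast_sum, sum_count, sum_fullShoe]; push_cast; ring

/-- Multiplying by the weight of the cards already dealt turns a conditional expectation into a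
count of longer deals. Impossible deals have weight zero, so the values of `drawCard` on shoes that
cannot occur do not matter. -/
theorem dealWeight_mul_drawCard (d : ℕ) (l : List (Fin 10)) (f : Fin 10 → Shoe → ℝ) :
    (dealWeight d l : ℝ) * drawCard (removed d l) f =
      (∑ r, (dealWeight d (r :: l) : ℝ) * f r (removed d (r :: l))) / (52 * d - l.length) := by
  by_cases h : dealWeight d l = 0
  · simp [dealWeight_cons, h]
  · have hs : ((∑ r, removed d l r : ℕ) : ℝ) = 52 * d - l.length := by
      rw [Nat.cast_sum, ← sum_cardsLeft]
      exact Finset.sum_congr rfl fun r _ => cast_removed h r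
    rw [drawCard, hs, Finset.mul_sum, Finset.sum_div]
    refine Finset.sum_congr rfl fun r _ => ?_
    rw [update_removed, dealWeight_cons]; push_cast; ring

/-! ### The payoff as a sum over Banker's information states -/

/-- The sum of Player's profits over the next card, where that card is dealt to Banker
(with two-card total `j`) if `act` is true, and is ignored otherwise. -/
noncomputable def outcome (d : ℕ) (act : Bool) (l : List (Fin 10)) (f j : Fin 10) : ℝ :=
  if act = true then ∑ c, cardsLeft d l c * profit f (j + c) else (52 * d - l.length) * profit f j

theorem outcome_perm {d : ℕ} {l l' : List (Fin 10)} (h : l.Perm l') (act : Bool) (f j : Fin 10) :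
    outcome d act l f j = outcome d act l' f j := by
  rw [outcome, outcome, cardsLeft_perm h, h.length_eq]

theorem dealWeight_mul_bankerTurn (d : ℕ) (T : Finset BankerInfo) (l : List (Fin 10))
    (f : Fin 10) (h : BankerHand) (k : Option (Fin 10)) (hl : (52 * d - l.length : ℝ) ≠ 0) :
    (dealWeight d l : ℝ) * bankerTurn T (removed d l) f h k * (52 * d - l.length) =
      dealWeight d l * outcome d (decide ((h, k) ∈ T)) l f (h.1.1 + h.1.2) := by
  unfold bankerTurn outcome
  by_cases hT : (h, k) ∈ T
  · rw [if_pos hT, dealWeight_mul_drawCard, div_mul_cancel₀ _ hl, if_pos (by simpa using hT),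
      Finset.mul_sum]
    refine Finset.sum_congr rfl fun c _ => ?_
    rw [cast_dealWeight_cons]; ring
  · rw [if_neg hT, if_neg (by simpa using hT)]; ring

/-- The number of ordered deals of six cards, as a real number. -/
noncomputable def sixDeals (d : ℕ) : ℝ :=
  52 * d * (52 * d - 1) * (52 * d - 2) * (52 * d - 3) * (52 * d - 4) * (52 * d - 5)

theorem decks_sub_ne_zero {d : ℕ} (hd : 1 ≤ d) {c : ℝ} (hc : c ≤ 5) : (52 * d - c : ℝ) ≠ 0 := by
  have : (1 : ℝ) ≤ d := by exact_mod_cast hd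
  have : 0 < (52 * d - c : ℝ) := by linarith
  exact this.ne'

theorem sixDeals_pos {d : ℕ} (hd : 1 ≤ d) : 0 < sixDeals d := by
  have : (1 : ℝ) ≤ d := by exact_mod_cast hd
  unfold sixDeals
  have h0 : (0 : ℝ) < 52 * d := by linarith
  have h1 : (0 : ℝ) < 52 * d - 1 := by linarith
  have h2 : (0 : ℝ) < 52 * d - 2 := by linarith
  have h3 : (0 : ℝ) < 52 * d - 3 := by linarith
  have h4 : (0 : ℝ) < 52 * d - 4 := by linarith
  have h5 : (0 : ℝ) < 52 * d - 5 := by linarith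
  positivity

theorem sixDeals_eq_descFactorial {d : ℕ} (hd : 1 ≤ d) :
    sixDeals d = ((52 * d).descFactorial 6 : ℝ) := by
  obtain ⟨m, rfl⟩ := Nat.exists_eq_add_of_le hd
  have : 52 * (1 + m) = (52 * m + 46) + 6 := by ring
  rw [this]
  simp only [Nat.descFactorial_succ, Nat.descFactorial_zero, sixDeals]
  have e : ∀ k ≤ 6, ((52 * m + 46 + 6 - k : ℕ) : ℝ) = 52 * m + 52 - k := by
    intro k hk
    rw [Nat.cast_sub (by omega)]; push_cast; ring
  push_cast [e 0, e 1, e 2, e 3, e 4, e 5]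
  ring

theorem baccaraPayoff_mul_sixDeals {d : ℕ} (hd : 1 ≤ d) (u : Bool) (T : Finset BankerInfo) :
    baccaraPayoff d u T * sixDeals d =
      ∑ x₁, ∑ x₂, ∑ y₁, ∑ y₂, (dealWeight d [y₂, y₁, x₂, x₁] : ℝ) *
        ((if h : x₁ + x₂ ≤ 7 ∧ y₁ + y₂ ≤ 7 then
          playerTurn u T (removed d [y₂, y₁, x₂, x₁]) (x₁ + x₂) (bankerHand y₁ y₂ h.2)
        else profit (x₁ + x₂) (y₁ + y₂)) * ((52 * d - 4) * (52 * d - 5))) := by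
  have h0 : (52 * d : ℝ) ≠ 0 := by simpa using decks_sub_ne_zero hd (c := 0) (by norm_num)
  have h1 := decks_sub_ne_zero hd (c := 1) (by norm_num)
  have h2 := decks_sub_ne_zero hd (c := 2) (by norm_num)
  have h3 := decks_sub_ne_zero hd (c := 3) (by norm_num)
  -- The weight 1 of the empty deal starts the recursion: each of the four cards then lengthens the
  -- weighted list by one.
  have key : baccaraPayoff d u T = (dealWeight d [] : ℝ) * baccaraPayoff d u T := by
    simp [dealWeight_nil]
  rw [key]
  unfold baccaraPayoff
  rw [← removed_nil]
  simp only [dealWeight_mul_drawCard, List.length_nil, List.length_cons]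
  push_cast
  simp only [sub_zero, Finset.sum_div, Finset.sum_mul]
  refine Finset.sum_congr rfl fun x₁ _ => Finset.sum_congr rfl fun x₂ _ =>
    Finset.sum_congr rfl fun y₁ _ => Finset.sum_congr rfl fun y₂ _ => ?_
  unfold sixDeals
  field_simp

/-- The contribution to the payoff of the deals in which Player's two-card total is `x`, those of
Player and Banker are finally `f` and (if Banker stands) `j`, and the cards of `l` are dealt besides
Player's hand. -/
noncomputable def totalValue (d : ℕ) (act : Bool) (l : List (Fin 10)) (x f j : Fin 10) : ℝ :=
  ∑ y, cardsLeft d l y * cardsLeft d (y :: l) (x - y) * outcome d act ((x - y) :: y :: l) f j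

/-- The part of Banker's information state besides Player's two cards, as a list of cards. -/
def infoCards (a b : Fin 10) : Option (Fin 10) → List (Fin 10)
  | none => [b, a]
  | some k => [k, b, a]

def thirdCard : Option (Fin 10) → Fin 10
  | none => 0
  | some k => k

/-- Weight of an information state of Banker, for a given order of the cards of his hand. -/
noncomputable def infoWeight (d : ℕ) (a b : Fin 10) (k : Option (Fin 10)) : ℝ :=
  (dealWeight d (infoCards a b k) : ℝ) * if k = none then (52 * d - 5 : ℝ) else 1

/-- The value of an information state, where Player's two-card total is restricted to `P`. -/
noncomputable def restrictedValue (d : ℕ) (P : Fin 10 → Prop) [DecidablePred P] (act : Bool)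
    (a b : Fin 10) (k : Option (Fin 10)) : ℝ :=
  ∑ x, if P x then totalValue d act (infoCards a b k) x (x + thirdCard k) (a + b) else 0

/-- Player's two-card total `x` is consistent with the third card `k`. -/
def Consistent (u : Bool) (k : Option (Fin 10)) (x : Fin 10) : Prop :=
  x ≤ 7 ∧ (PlayerDraws u x ↔ k ≠ none)

instance (u : Bool) (k : Option (Fin 10)) (x : Fin 10) : Decidable (Consistent u k x) := by
  unfold Consistent; infer_instance

/-- Change of variables from the two cards to the first card and the total, possible because
addition modulo 10 is a group. -/
theorem sum_restrict (P : Fin 10 → Prop) [DecidablePred P] (g : Fin 10 → Fin 10 → ℝ) :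
    (∑ x₁, ∑ x₂, if P (x₁ + x₂) then g x₁ x₂ else 0) =
      ∑ x, if P x then ∑ y, g y (x - y) else 0 := by
  have : ∀ x, (if P x then ∑ y, g y (x - y) else 0) = ∑ y, if P x then g y (x - y) else 0 := by
    intro x; split_ifs <;> simp
  simp only [this]
  refine Eq.trans (Finset.sum_congr rfl fun y _ => ?_) Finset.sum_comm
  refine Fintype.sum_equiv (Equiv.addLeft y) _ _ fun z => ?_
  simp

theorem infoCards_perm (y₁ y₂ x₁ x₂ : Fin 10) (k : Option (Fin 10)) :
    (k.toList ++ [y₂, y₁, x₂, x₁]).Perm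
      (x₂ :: x₁ :: infoCards (min y₁ y₂) (max y₁ y₂) k) := by
  have h : ([y₂, y₁] : List (Fin 10)).Perm [max y₁ y₂, min y₁ y₂] := by
    rcases le_total y₁ y₂ with h | h
    · simp [h]
    · simpa [h] using List.Perm.swap y₁ y₂ []
  have h' : (k.toList ++ [y₂, y₁]).Perm (infoCards (min y₁ y₂) (max y₁ y₂) k) := by
    cases k with
    | none => exact h
    | some k => exact h.cons k
  have e : k.toList ++ [y₂, y₁, x₂, x₁] = (k.toList ++ [y₂, y₁]) ++ [x₂, x₁] := by simp
  rw [e]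
  exact List.perm_append_comm.trans (by simpa using h')

theorem bankerHand_total (y₁ y₂ : Fin 10) (h : y₁ + y₂ ≤ 7) :
    (bankerHand y₁ y₂ h).1.1 + (bankerHand y₁ y₂ h).1.2 = y₁ + y₂ := min_add_max _ _

/-- Of the factors 52d - 4 and 52d - 5, a third card for Player uses up the first and `outcome` the
second. If Player stands, `outcome` uses the first and the factor 52d - 5 remains; this explains the
case distinction in `infoWeight`. -/
theorem dealWeight_mul_playerTurn {d : ℕ} (hd : 1 ≤ d) (u : Bool) (T : Finset BankerInfo)
    (x₁ x₂ y₁ y₂ : Fin 10) (hy : y₁ + y₂ ≤ 7) :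
    (dealWeight d [y₂, y₁, x₂, x₁] : ℝ) *
        (playerTurn u T (removed d [y₂, y₁, x₂, x₁]) (x₁ + x₂) (bankerHand y₁ y₂ hy) *
          ((52 * d - 4) * (52 * d - 5))) =
      ∑ k : Option (Fin 10), if (PlayerDraws u (x₁ + x₂) ↔ k ≠ none) then
        (dealWeight d (k.toList ++ [y₂, y₁, x₂, x₁]) : ℝ) *
          outcome d (decide ((bankerHand y₁ y₂ hy, k) ∈ T)) (k.toList ++ [y₂, y₁, x₂, x₁])
            (x₁ + x₂ + thirdCard k) (y₁ + y₂) * (if k = none then (52 * d - 5 : ℝ) else 1)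
        else 0 := by
  have h4 := decks_sub_ne_zero hd (c := 4) (by norm_num)
  have h5 := decks_sub_ne_zero hd (c := 5) (by norm_num)
  rw [Fintype.sum_option]
  unfold playerTurn
  by_cases hx : PlayerDraws u (x₁ + x₂)
  · rw [if_pos hx, ← mul_assoc, dealWeight_mul_drawCard]
    simp only [hx, List.length_cons, List.length_nil]
    norm_num
    rw [div_mul_eq_mul_div, mul_left_comm, mul_div_cancel_left₀ _ h4, Finset.sum_mul]
    refine Finset.sum_congr rfl fun k _ => ?_
    have := dealWeight_mul_bankerTurn d T [k, y₂, y₁, x₂, x₁] (x₁ + x₂ + k)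
      (bankerHand y₁ y₂ hy) (some k) (by simpa using h5)
    rw [bankerHand_total] at this
    norm_num at this
    exact this
  · have := dealWeight_mul_bankerTurn d T [y₂, y₁, x₂, x₁] (x₁ + x₂)
      (bankerHand y₁ y₂ hy) none (by simpa using h4)
    rw [bankerHand_total] at this
    norm_num at this
    simp [hx, thirdCard]
    rw [← this]; ring

theorem profit_swap (x y : Fin 10) : profit x y = - profit y x := by
  unfold profit
  rcases lt_trichotomy x y with h | h | h
  · simp [h, h.not_gt]
  · simp [h]
  · simp [h, h.not_gt]

/-- Exchanging the two hands preserves the weight of the deal and the condition that some hand is a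
natural, but changes the sign of the profit. The sum is therefore its own negative. -/
theorem sum_naturals (d : ℕ) :
    (∑ x₁, ∑ x₂, ∑ y₁, ∑ y₂, if x₁ + x₂ ≤ 7 ∧ y₁ + y₂ ≤ 7 then 0 else
      (dealWeight d [y₂, y₁, x₂, x₁] : ℝ) * profit (x₁ + x₂) (y₁ + y₂)) = 0 := by
  set F : Fin 10 → Fin 10 → Fin 10 → Fin 10 → ℝ := fun x₁ x₂ y₁ y₂ =>
    if x₁ + x₂ ≤ 7 ∧ y₁ + y₂ ≤ 7 then 0 else
      (dealWeight d [y₂, y₁, x₂, x₁] : ℝ) * profit (x₁ + x₂) (y₁ + y₂) with hF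
  have hswap : ∀ x₁ x₂ y₁ y₂, F x₁ x₂ y₁ y₂ = - F y₁ y₂ x₁ x₂ := by
    intro x₁ x₂ y₁ y₂
    have hp : dealWeight d [y₂, y₁, x₂, x₁] = dealWeight d [x₂, x₁, y₂, y₁] :=
      dealWeight_perm (List.perm_append_comm (l₁ := [y₂, y₁]) (l₂ := [x₂, x₁]))
    simp only [hF]
    rw [hp, profit_swap]
    by_cases h : x₁ + x₂ ≤ 7 ∧ y₁ + y₂ ≤ 7
    · rw [if_pos h, if_pos h.symm]; simp
    · rw [if_neg h, if_neg (fun h' => h h'.symm)]; ring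
  have hsum : ∀ G : Fin 10 → Fin 10 → Fin 10 → Fin 10 → ℝ,
      ∑ x₁, ∑ x₂, ∑ y₁, ∑ y₂, G x₁ x₂ y₁ y₂ =
        ∑ p : Fin 10 × Fin 10, ∑ q : Fin 10 × Fin 10, G p.1 p.2 q.1 q.2 := by
    intro G; simp only [Fintype.sum_prod_type]
  change ∑ x₁, ∑ x₂, ∑ y₁, ∑ y₂, F x₁ x₂ y₁ y₂ = 0
  have h1 := hsum F
  have h2 : ∑ p : Fin 10 × Fin 10, ∑ q : Fin 10 × Fin 10, F p.1 p.2 q.1 q.2 =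
      - ∑ p : Fin 10 × Fin 10, ∑ q : Fin 10 × Fin 10, F p.1 p.2 q.1 q.2 := by
    conv_lhs => rw [Finset.sum_comm]
    simp only [← Finset.sum_neg_distrib]
    exact Finset.sum_congr rfl fun p _ => Finset.sum_congr rfl fun q _ => hswap _ _ _ _
  linarith

/-- The value of an information state, for a given order of the cards of Banker's hand. -/
noncomputable def infoValue (d : ℕ) (u act : Bool) (a b : Fin 10) (k : Option (Fin 10)) : ℝ :=
  infoWeight d a b k * restrictedValue d (Consistent u k) act a b k

/-- Weights and outcomes depend only on the multiset of dealt cards. So Player's two cards may be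
treated as dealt after the cards that Banker knows, and the weight of the latter factors out. -/
theorem infoValue_eq_sum (d : ℕ) (u act : Bool) (y₁ y₂ : Fin 10) (k : Option (Fin 10)) :
    infoValue d u act (min y₁ y₂) (max y₁ y₂) k =
      ∑ x₁, ∑ x₂, if Consistent u k (x₁ + x₂) then
        (dealWeight d (k.toList ++ [y₂, y₁, x₂, x₁]) : ℝ) *
          outcome d act (k.toList ++ [y₂, y₁, x₂, x₁])
            (x₁ + x₂ + thirdCard k) (y₁ + y₂) * (if k = none then (52 * d - 5 : ℝ) else 1)
        else 0 := by
  have e : ∀ x₁ x₂, (dealWeight d (k.toList ++ [y₂, y₁, x₂, x₁]) : ℝ) *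
          outcome d act (k.toList ++ [y₂, y₁, x₂, x₁])
            (x₁ + x₂ + thirdCard k) (y₁ + y₂) * (if k = none then (52 * d - 5 : ℝ) else 1) =
      (infoWeight d (min y₁ y₂) (max y₁ y₂) k) *
        (cardsLeft d (infoCards (min y₁ y₂) (max y₁ y₂) k) x₁ *
        cardsLeft d (x₁ :: infoCards (min y₁ y₂) (max y₁ y₂) k) x₂ *
        outcome d act (x₂ :: x₁ :: infoCards (min y₁ y₂) (max y₁ y₂) k)
            (x₁ + x₂ + thirdCard k) (y₁ + y₂)) := by
    intro x₁ x₂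
    rw [dealWeight_perm (infoCards_perm y₁ y₂ x₁ x₂ k), outcome_perm (infoCards_perm y₁ y₂ x₁ x₂ k),
      cast_dealWeight_cons, cast_dealWeight_cons, infoWeight]
    ring
  simp only [e]
  rw [sum_restrict, infoValue, restrictedValue, Finset.mul_sum]
  refine Finset.sum_congr rfl fun x _ => ?_
  split_ifs
  · rw [totalValue, Finset.mul_sum, min_add_max]
    refine Finset.sum_congr rfl fun y _ => ?_
    rw [add_sub_cancel]
  · simp

theorem baccaraPayoff_eq_sum_infoValue {d : ℕ} (hd : 1 ≤ d) (u : Bool) (T : Finset BankerInfo) :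
    baccaraPayoff d u T * sixDeals d =
      ∑ y₁, ∑ y₂, if h : y₁ + y₂ ≤ 7 then
        ∑ k, infoValue d u (decide ((bankerHand y₁ y₂ h, k) ∈ T))
          (bankerHand y₁ y₂ h).1.1 (bankerHand y₁ y₂ h).1.2 k else 0 := by
  have hterm : ∀ x₁ x₂ y₁ y₂ : Fin 10, (dealWeight d [y₂, y₁, x₂, x₁] : ℝ) *
        ((if h : x₁ + x₂ ≤ 7 ∧ y₁ + y₂ ≤ 7 then
          playerTurn u T (removed d [y₂, y₁, x₂, x₁]) (x₁ + x₂) (bankerHand y₁ y₂ h.2)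
        else profit (x₁ + x₂) (y₁ + y₂)) * ((52 * d - 4) * (52 * d - 5))) =
      (if x₁ + x₂ ≤ 7 ∧ y₁ + y₂ ≤ 7 then 0 else
        (dealWeight d [y₂, y₁, x₂, x₁] : ℝ) * profit (x₁ + x₂) (y₁ + y₂)) *
          ((52 * d - 4) * (52 * d - 5)) +
      (if hy : y₁ + y₂ ≤ 7 then ∑ k : Option (Fin 10), if Consistent u k (x₁ + x₂) then
        (dealWeight d (k.toList ++ [y₂, y₁, x₂, x₁]) : ℝ) *
          outcome d (decide ((bankerHand y₁ y₂ hy, k) ∈ T)) (k.toList ++ [y₂, y₁, x₂, x₁])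
            (x₁ + x₂ + thirdCard k) (y₁ + y₂) * (if k = none then (52 * d - 5 : ℝ) else 1)
        else 0 else 0) := by
    intro x₁ x₂ y₁ y₂
    by_cases hy : y₁ + y₂ ≤ 7
    · by_cases hx : x₁ + x₂ ≤ 7
      · rw [dif_pos ⟨hx, hy⟩, if_pos ⟨hx, hy⟩, dif_pos hy, dealWeight_mul_playerTurn hd]
        simp only [Consistent, hx, true_and, zero_mul, zero_add]
      · rw [dif_neg (fun h => hx h.1), if_neg (fun h => hx h.1), dif_pos hy]
        simp only [Consistent, hx, false_and, if_false, Finset.sum_const_zero]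
        ring
    · rw [dif_neg (fun h => hy h.2), if_neg (fun h => hy h.2), dif_neg hy]
      ring
  rw [baccaraPayoff_mul_sixDeals hd]
  simp only [hterm, Finset.sum_add_distrib, ← Finset.sum_mul]
  rw [sum_naturals, zero_mul, zero_add]
  have hsum : ∀ G : Fin 10 → Fin 10 → Fin 10 → Fin 10 → ℝ,
      ∑ x₁, ∑ x₂, ∑ y₁, ∑ y₂, G x₁ x₂ y₁ y₂ = ∑ y₁, ∑ y₂, ∑ x₁, ∑ x₂, G x₁ x₂ y₁ y₂ := by
    intro G
    have : ∀ H : Fin 10 → Fin 10 → Fin 10 → Fin 10 → ℝ, ∑ x₁, ∑ x₂, ∑ y₁, ∑ y₂, H x₁ x₂ y₁ y₂ =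
        ∑ p : Fin 10 × Fin 10, ∑ q : Fin 10 × Fin 10, H p.1 p.2 q.1 q.2 := by
      intro H; simp only [Fintype.sum_prod_type]
    rw [this, Finset.sum_comm, this (fun y₁ y₂ x₁ x₂ => G x₁ x₂ y₁ y₂)]
  rw [hsum]
  refine Finset.sum_congr rfl fun y₁ _ => Finset.sum_congr rfl fun y₂ _ => ?_
  by_cases hy : y₁ + y₂ ≤ 7
  · simp only [dif_pos hy]
    have : ∀ k, infoValue d u (decide ((bankerHand y₁ y₂ hy, k) ∈ T))
          (bankerHand y₁ y₂ hy).1.1 (bankerHand y₁ y₂ hy).1.2 k = _ :=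
      fun k => infoValue_eq_sum d u (decide ((bankerHand y₁ y₂ hy, k) ∈ T)) y₁ y₂ k
    simp only [this]
    symm
    rw [Finset.sum_comm]
    refine Finset.sum_congr rfl fun x₁ _ => ?_
    rw [Finset.sum_comm]
  · simp only [dif_neg hy, Finset.sum_const_zero]

/-- The number of orders of the cards of a hand. -/
def orders (a b : Fin 10) : ℕ := if a = b then 1 else 2

theorem sum_bankerHand (g : BankerHand → ℝ) :
    (∑ y₁, ∑ y₂, if h : y₁ + y₂ ≤ 7 then g (bankerHand y₁ y₂ h) else 0) =
      ∑ h : BankerHand, orders h.1.1 h.1.2 * g h := by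
  have e : ∀ y₁ y₂ : Fin 10, (if h : y₁ + y₂ ≤ 7 then g (bankerHand y₁ y₂ h) else 0) =
      ∑ h : BankerHand, if (min y₁ y₂, max y₁ y₂) = h.1 then g h else 0 := by
    intro y₁ y₂
    by_cases hy : y₁ + y₂ ≤ 7
    · rw [dif_pos hy, Finset.sum_eq_single (bankerHand y₁ y₂ hy)]
      · simp [bankerHand]
      · intro h _ hne
        rw [if_neg]
        intro h'
        exact hne (Subtype.ext h'.symm)
      · simp
    · rw [dif_neg hy, Finset.sum_eq_zero]
      intro h _
      rw [if_neg]
      intro h'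
      have := h.2.2
      rw [← h', min_add_max] at this
      exact hy this
  simp only [e]
  rw [← Fintype.sum_prod_type' (f := fun y₁ y₂ : Fin 10 =>
    ∑ h : BankerHand, if (min y₁ y₂, max y₁ y₂) = h.1 then g h else 0), Finset.sum_comm]
  refine Finset.sum_congr rfl fun h _ => ?_
  rw [← Finset.sum_filter, Finset.sum_const, nsmul_eq_mul]
  congr 2
  have : ∀ a b : Fin 10, a ≤ b → (Finset.univ.filter fun y : Fin 10 × Fin 10 =>
      (min y.1 y.2, max y.1 y.2) = (a, b)).card = orders a b := by
    decide +kernel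
  exact this h.1.1 h.1.2 h.2.1

/-- The separation of Banker's decisions: membership of one information state in `T` affects one
summand only. -/
theorem baccaraPayoff_eq {d : ℕ} (hd : 1 ≤ d) (u : Bool) (T : Finset BankerInfo) :
    baccaraPayoff d u T * sixDeals d =
      ∑ i : BankerInfo, orders i.1.1.1 i.1.1.2 *
        infoValue d u (decide (i ∈ T)) i.1.1.1 i.1.1.2 i.2 := by
  rw [baccaraPayoff_eq_sum_infoValue hd, Fintype.sum_prod_type,
    sum_bankerHand fun h => ∑ k, infoValue d u (decide ((h, k) ∈ T)) h.1.1 h.1.2 k]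
  simp only [Finset.mul_sum]

/-! ### Games in which player I has two pure strategies -/

section TwoRowGames

variable {J : Type*} [Fintype J] {A : Bool → J → ℝ}

theorem expectedPayoff_eq_sum (x : Bool → ℝ) (y : J → ℝ) :
    expectedPayoff A x y = ∑ j, (x true * A true j + x false * A false j) * y j := by
  simp only [expectedPayoff, Fintype.sum_bool, ← Finset.sum_add_distrib, add_mul]

variable [DecidableEq J]

theorem expectedPayoff_single (x : Bool → ℝ) (j : J) :
    expectedPayoff A x (Pi.single j 1) = x true * A true j + x false * A false j := by
  rw [expectedPayoff_eq_sum, Finset.sum_eq_single j]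
  · simp
  · intro b _ hb; simp [hb]
  · simp

theorem expectedPayoff_mix (x : Bool → ℝ) (S D : J) (q : ℝ) :
    expectedPayoff A x ((1 - q) • Pi.single S 1 + q • Pi.single D 1) =
      (1 - q) * (x true * A true S + x false * A false S) +
        q * (x true * A true D + x false * A false D) := by
  rw [← expectedPayoff_single, ← expectedPayoff_single]
  simp only [expectedPayoff_eq_sum, Finset.mul_sum, ← Finset.sum_add_distrib, Pi.add_apply,
    Pi.smul_apply, smul_eq_mul]
  exact Finset.sum_congr rfl fun j _ => by ring

theorem playerMix_mem_stdSimplex {p : ℝ} (h0 : 0 ≤ p) (h1 : p ≤ 1) :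
    playerMix p ∈ stdSimplex ℝ Bool := by
  refine ⟨fun u => ?_, by simp [playerMix]⟩
  cases u <;> simp [playerMix, h0, h1]

theorem mix_mem_stdSimplex (S D : J) {q : ℝ} (h0 : 0 ≤ q) (h1 : q ≤ 1) :
    ((1 - q) • Pi.single S 1 + q • Pi.single D 1 : J → ℝ) ∈ stdSimplex ℝ J :=
  convex_stdSimplex ℝ J (single_mem_stdSimplex ℝ S) (single_mem_stdSimplex ℝ D)
    (by linarith) h0 (by ring)

/-- A game with two rows in which player I's mixture `p` is an equalizer on the columns `S` and `D`
and does strictly better against all others, and player II's mixture `q` of `S` and `D` is an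
equalizer. -/
theorem unique_optimal_of_equalizers {p q v : ℝ} {S D : J} (hp0 : 0 < p) (hp1 : p < 1)
    (hq0 : 0 < q) (hq1 : q < 1)
    (hS : p * A true S + (1 - p) * A false S = v) (hD : p * A true D + (1 - p) * A false D = v)
    (hlt : ∀ j, j ≠ S → j ≠ D → v < p * A true j + (1 - p) * A false j)
    (hq : ∀ u, (1 - q) * A u S + q * A u D = v)
    (hne : A true S - A false S ≠ A true D - A false D) :
    (∀ x, IsOptimalI A x ↔ x = playerMix p) ∧
    (∀ y, IsOptimalII A y ↔ y = (1 - q) • Pi.single S 1 + q • Pi.single D 1) ∧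
    IsGameValue A v := by
  have hSD : S ≠ D := by rintro rfl; exact hne rfl
  have hle : ∀ j, v ≤ p * A true j + (1 - p) * A false j := by
    intro j
    by_cases h1 : j = S
    · rw [h1, hS]
    by_cases h2 : j = D
    · rw [h2, hD]
    exact (hlt j h1 h2).le
  have hxmem := playerMix_mem_stdSimplex hp0.le hp1.le
  have hymem := mix_mem_stdSimplex S D hq0.le hq1.le
  have hI : GuaranteesI A (playerMix p) v := by
    intro y hy
    rw [expectedPayoff_eq_sum]
    calc v = ∑ j, v * y j := by rw [← Finset.mul_sum, hy.2, mul_one]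
      _ ≤ _ := Finset.sum_le_sum fun j _ => mul_le_mul_of_nonneg_right
        (by simpa [playerMix] using hle j) (hy.1 j)
  have hval : ∀ x ∈ stdSimplex ℝ Bool,
      expectedPayoff A x ((1 - q) • Pi.single S 1 + q • Pi.single D 1) = v := by
    intro x hx
    have hx1 : x true + x false = 1 := by simpa using hx.2
    rw [expectedPayoff_mix]
    linear_combination x true * hq true + x false * hq false + v * hx1
  have hII : GuaranteesII A ((1 - q) • Pi.single S 1 + q • Pi.single D 1) v :=
    fun x hx => (hval x hx).le
  refine ⟨fun x => ⟨fun hx => ?_, ?_⟩, fun y => ⟨fun hy => ?_, ?_⟩, ⟨_, hxmem, hI⟩, ⟨_, hymem, hII⟩⟩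
  · have hx1 : x true + x false = 1 := by simpa using hx.1.2
    have hg := hx.2 _ hxmem v hI
    have h1 := hg _ (single_mem_stdSimplex ℝ S)
    have h2 := hg _ (single_mem_stdSimplex ℝ D)
    have h3 := hval x hx.1
    rw [expectedPayoff_mix] at h3
    rw [expectedPayoff_single] at h1 h2
    -- The payoffs of `x` in the columns S and D are at least v, while their average with positive
    -- weights 1 - q and q is v; so both equal v.
    have e1 : x true * A true S + x false * A false S = v := by nlinarith
    have e2 : x true * A true D + x false * A false D = v := by nlinarith
    have e3 : (x true - p) * ((A true S - A false S) - (A true D - A false D)) = 0 := by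
      linear_combination e1 - e2 - hS + hD - (A false S - A false D) * hx1
    have e4 : x true = p := by
      rcases mul_eq_zero.1 e3 with h | h
      · linarith
      · exact absurd (by linarith) hne
    funext u
    cases u
    · simp [playerMix]; linarith
    · simp [playerMix, e4]
  · rintro rfl
    refine ⟨hxmem, fun x' hx' w hw y hy => ?_⟩
    have h1 := hw _ hymem
    rw [hval x' hx'] at h1
    exact h1.trans (hI y hy)
  · have hg := hy.2 _ hymem v hII
    have h1 := hg _ (playerMix_mem_stdSimplex zero_le_one le_rfl)
    have h2 := hg _ (playerMix_mem_stdSimplex le_rfl zero_le_one)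
    have h3 := hI y hy.1
    have hmix : expectedPayoff A (playerMix p) y = p * expectedPayoff A (playerMix 1) y +
        (1 - p) * expectedPayoff A (playerMix 0) y := by
      simp only [expectedPayoff_eq_sum, Finset.mul_sum, ← Finset.sum_add_distrib, playerMix]
      exact Finset.sum_congr rfl fun j _ => by norm_num; ring
    have e1 : expectedPayoff A (playerMix 1) y = v := by nlinarith
    have e2 : expectedPayoff A (playerMix 0) y = v := by nlinarith
    -- Complementary slackness: the summands are nonnegative, so `y` puts no mass on a column where
    -- Player's mixture earns more than v.
    have e3 : ∑ j, (p * A true j + (1 - p) * A false j - v) * y j = 0 := by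
      rw [Finset.sum_congr rfl fun j _ => sub_mul _ v (y j), Finset.sum_sub_distrib,
        ← Finset.mul_sum, hy.1.2, mul_one]
      have : expectedPayoff A (playerMix p) y = v := by rw [hmix, e1, e2]; ring
      rw [expectedPayoff_eq_sum] at this
      simp only [playerMix, if_true, Bool.false_eq_true, if_false] at this
      rw [this, sub_self]
    have e4 : ∀ j, j ≠ S → j ≠ D → y j = 0 := by
      intro j hjS hjD
      have := (Finset.sum_eq_zero_iff_of_nonneg fun j _ =>
        mul_nonneg (sub_nonneg.2 (hle j)) (hy.1.1 j)).1 e3 j (Finset.mem_univ j)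
      rcases mul_eq_zero.1 this with h | h
      · exact absurd h (sub_pos.2 (hlt j hjS hjD)).ne'
      · exact h
    have e5 : y = (1 - y D) • Pi.single S 1 + y D • Pi.single D 1 := by
      have hsum : y S + y D = 1 := by
        rw [← hy.1.2, ← Finset.sum_pair hSD]
        refine Finset.sum_subset (Finset.subset_univ _) fun j _ hj => ?_
        simp only [Finset.mem_insert, Finset.mem_singleton, not_or] at hj
        exact e4 j hj.1 hj.2
      funext j
      by_cases h1 : j = S
      · subst h1; simp [hSD]; linarith
      by_cases h2 : j = D
      · subst h2; simp [hSD.symm]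
      · simp [h1, h2, e4 j h1 h2]
    rw [e5, expectedPayoff_mix] at e1 e2
    simp only [playerMix, if_true, Bool.false_eq_true, if_false] at e1 e2
    -- Supported on S and D, `y` equalizes the two rows, a linear condition on `y D` whose leading
    -- coefficient is nonzero by `hne`.
    have e6 : (y D - q) * ((A true S - A false S) - (A true D - A false D)) = 0 := by
      linear_combination e2 - e1 + hq true - hq false
    have e7 : y D = q := by
      rcases mul_eq_zero.1 e6 with h | h
      · linarith
      · exact absurd (by linarith) hne
    rw [e5, e7]
  · rintro rfl
    refine ⟨hymem, fun y' hy' w hw x hx => ?_⟩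
    have h1 := hw _ hxmem
    rw [hval x hx]
    exact (hI y' hy').trans h1

end TwoRowGames

/-- If the payoff is a sum of independent contributions of the elements of `ι`, the sets that minimize
it are determined up to the one element whose contribution does not depend on its membership. -/
theorem sum_lt_sum_of_ne {ι : Type*} [Fintype ι] [DecidableEq ι] (g : ι → Bool → ℝ)
    (S T : Finset ι) (m : ι) (hmS : m ∉ S) (hm : g m true = g m false)
    (hin : ∀ i ∈ S, g i true < g i false) (hout : ∀ i, i ∉ S → i ≠ m → g i false < g i true)
    (hS : T ≠ S) (hD : T ≠ insert m S) :
    ∑ i, g i (decide (i ∈ S)) < ∑ i, g i (decide (i ∈ T)) := by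
  have hlt : ∀ i, i ≠ m → (i ∈ T ↔ ¬ i ∈ S) → g i (decide (i ∈ S)) < g i (decide (i ∈ T)) := by
    intro i him h
    by_cases hi : i ∈ S
    · simpa [hi, h] using hin i hi
    · simpa [hi, h] using hout i hi him
  apply Finset.sum_lt_sum
  · intro i _
    by_cases him : i = m
    · subst him
      by_cases hT : i ∈ T <;> simp [hmS, hT, hm]
    · by_cases h : (i ∈ T ↔ ¬ i ∈ S)
      · exact (hlt i him h).le
      · have : decide (i ∈ S) = decide (i ∈ T) := by
          rw [decide_eq_decide]; tauto
        rw [this]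
  -- Without a strict inequality, `T` agrees with `S` off `m`, which leaves only the two excluded
  -- sets.
  · by_contra hcon
    push Not at hcon
    have heq : ∀ i, i ≠ m → (i ∈ T ↔ i ∈ S) := by
      intro i him
      by_contra h
      exact absurd (hlt i him (by tauto)) (not_lt.2 (hcon i (Finset.mem_univ i)))
    by_cases hmT : m ∈ T
    · refine hD (Finset.ext fun i => ?_)
      by_cases him : i = m
      · simp [him, hmT]
      · simp [him, heq i him]
    · refine hS (Finset.ext fun i => ?_)
      by_cases him : i = m
      · simp [him, hmT, hmS]
      · exact heq i him

/-! ### Polynomials of small degree with natural number coefficients, for evaluation in the kernel -/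

/-- The variable is e = d - 1, coefficients in order of increasing degree. Natural coefficients keep
the arithmetic on numerals; signs are carried by formal differences. -/
structure Lin where
  c0 : ℕ
  c1 : ℕ

structure Quad where
  c0 : ℕ
  c1 : ℕ
  c2 : ℕ

structure Cub where
  c0 : ℕ
  c1 : ℕ
  c2 : ℕ
  c3 : ℕ

/-- Polynomials of degree at most six. -/
structure Sext where
  c0 : ℕ
  c1 : ℕ
  c2 : ℕ
  c3 : ℕ
  c4 : ℕ
  c5 : ℕ
  c6 : ℕ

/-- A formal difference of cubic polynomials. -/
structure CubDiff where
  pos : Cub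
  neg : Cub

/-- A formal difference of polynomials of degree at most six. -/
structure SextDiff where
  pos : Sext
  neg : Sext

namespace Lin

def mul (p q : Lin) : Quad :=
  ⟨Nat.mul p.c0 q.c0, Nat.add (Nat.mul p.c0 q.c1) (Nat.mul p.c1 q.c0), Nat.mul p.c1 q.c1⟩

noncomputable def eval (e : ℝ) (p : Lin) : ℝ := p.c0 + p.c1 * e

end Lin

namespace Quad

def add (p q : Quad) : Quad := ⟨Nat.add p.c0 q.c0, Nat.add p.c1 q.c1, Nat.add p.c2 q.c2⟩

def smul (a : ℕ) (p : Quad) : Quad := ⟨Nat.mul a p.c0, Nat.mul a p.c1, Nat.mul a p.c2⟩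

def mulLin (p : Quad) (q : Lin) : Cub :=
  ⟨Nat.mul p.c0 q.c0, Nat.add (Nat.mul p.c0 q.c1) (Nat.mul p.c1 q.c0),
    Nat.add (Nat.mul p.c1 q.c1) (Nat.mul p.c2 q.c0), Nat.mul p.c2 q.c1⟩

def toCub (p : Quad) : Cub := ⟨p.c0, p.c1, p.c2, 0⟩

/-- The sum of `f x` over the digits `x`. -/
def sum (f : ℕ → Quad) : Quad :=
  ((((f 0).add (f 1)).add ((f 2).add (f 3))).add (((f 4).add (f 5)).add ((f 6).add (f 7)))).add
    ((f 8).add (f 9))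

noncomputable def eval (e : ℝ) (p : Quad) : ℝ := p.c0 + p.c1 * e + p.c2 * e ^ 2

end Quad

namespace Cub

def add (p q : Cub) : Cub :=
  ⟨Nat.add p.c0 q.c0, Nat.add p.c1 q.c1, Nat.add p.c2 q.c2, Nat.add p.c3 q.c3⟩

def smul (a : ℕ) (p : Cub) : Cub :=
  ⟨Nat.mul a p.c0, Nat.mul a p.c1, Nat.mul a p.c2, Nat.mul a p.c3⟩

def mul (p q : Cub) : Sext :=
  ⟨Nat.mul p.c0 q.c0,
    Nat.add (Nat.mul p.c0 q.c1) (Nat.mul p.c1 q.c0),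
    Nat.add (Nat.add (Nat.mul p.c0 q.c2) (Nat.mul p.c1 q.c1)) (Nat.mul p.c2 q.c0),
    Nat.add (Nat.add (Nat.mul p.c0 q.c3) (Nat.mul p.c1 q.c2))
      (Nat.add (Nat.mul p.c2 q.c1) (Nat.mul p.c3 q.c0)),
    Nat.add (Nat.add (Nat.mul p.c1 q.c3) (Nat.mul p.c2 q.c2)) (Nat.mul p.c3 q.c1),
    Nat.add (Nat.mul p.c2 q.c3) (Nat.mul p.c3 q.c2),
    Nat.mul p.c3 q.c3⟩

def beq (p q : Cub) : Bool :=
  Nat.beq p.c0 q.c0 && Nat.beq p.c1 q.c1 && Nat.beq p.c2 q.c2 && Nat.beq p.c3 q.c3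

noncomputable def eval (e : ℝ) (p : Cub) : ℝ := p.c0 + p.c1 * e + p.c2 * e ^ 2 + p.c3 * e ^ 3

end Cub

namespace Sext

def add (p q : Sext) : Sext :=
  ⟨Nat.add p.c0 q.c0, Nat.add p.c1 q.c1, Nat.add p.c2 q.c2, Nat.add p.c3 q.c3,
    Nat.add p.c4 q.c4, Nat.add p.c5 q.c5, Nat.add p.c6 q.c6⟩

def zero : Sext := ⟨0, 0, 0, 0, 0, 0, 0⟩

/-- Coefficientwise comparison, strict in the constant term. -/
def lt (p q : Sext) : Bool :=
  Nat.blt p.c0 q.c0 && Nat.ble p.c1 q.c1 && Nat.ble p.c2 q.c2 && Nat.ble p.c3 q.c3 &&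
    Nat.ble p.c4 q.c4 && Nat.ble p.c5 q.c5 && Nat.ble p.c6 q.c6

def beq (p q : Sext) : Bool :=
  Nat.beq p.c0 q.c0 && Nat.beq p.c1 q.c1 && Nat.beq p.c2 q.c2 && Nat.beq p.c3 q.c3 &&
    Nat.beq p.c4 q.c4 && Nat.beq p.c5 q.c5 && Nat.beq p.c6 q.c6

noncomputable def eval (e : ℝ) (p : Sext) : ℝ :=
  p.c0 + p.c1 * e + p.c2 * e ^ 2 + p.c3 * e ^ 3 + p.c4 * e ^ 4 + p.c5 * e ^ 5 + p.c6 * e ^ 6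

end Sext

namespace CubDiff

def add (p q : CubDiff) : CubDiff := ⟨p.pos.add q.pos, p.neg.add q.neg⟩

def sub (p q : CubDiff) : CubDiff := ⟨p.pos.add q.neg, p.neg.add q.pos⟩

def mulCub (p : CubDiff) (q : Cub) : SextDiff := ⟨q.mul p.pos, q.mul p.neg⟩

/-- Equality as polynomials. -/
def equiv (p q : CubDiff) : Bool := (p.pos.add q.neg).beq (p.neg.add q.pos)

noncomputable def eval (e : ℝ) (p : CubDiff) : ℝ := p.pos.eval e - p.neg.eval e

end CubDiff

namespace SextDiff

def add (p q : SextDiff) : SextDiff := ⟨p.pos.add q.pos, p.neg.add q.neg⟩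

def zero : SextDiff := ⟨Sext.zero, Sext.zero⟩

/-- The sum of `f x` over the values `x` of a card. -/
def sum (f : Fin 10 → SextDiff) : SextDiff :=
  ((((f ⟨0, by decide⟩).add (f ⟨1, by decide⟩)).add
    ((f ⟨2, by decide⟩).add (f ⟨3, by decide⟩))).add
    (((f ⟨4, by decide⟩).add (f ⟨5, by decide⟩)).add
    ((f ⟨6, by decide⟩).add (f ⟨7, by decide⟩)))).add
    ((f ⟨8, by decide⟩).add (f ⟨9, by decide⟩))

/-- Equality as polynomials. -/
def equiv (p q : SextDiff) : Bool := (p.pos.add q.neg).beq (p.neg.add q.pos)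

noncomputable def eval (e : ℝ) (p : SextDiff) : ℝ := p.pos.eval e - p.neg.eval e

end SextDiff

/-! ### Evaluation respects the polynomial operations. -/

section Eval

variable (e : ℝ)

theorem Lin.eval_mul (p q : Lin) : (p.mul q).eval e = p.eval e * q.eval e := by
  simp [Lin.mul, Lin.eval, Quad.eval]; ring

theorem Quad.eval_add (p q : Quad) : (p.add q).eval e = p.eval e + q.eval e := by
  simp [Quad.add, Quad.eval]; ring

theorem Quad.eval_smul (a : ℕ) (p : Quad) : (p.smul a).eval e = a * p.eval e := by
  simp [Quad.smul, Quad.eval]; ring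

theorem Quad.eval_mulLin (p : Quad) (q : Lin) : (p.mulLin q).eval e = p.eval e * q.eval e := by
  simp [Quad.mulLin, Lin.eval, Quad.eval, Cub.eval]; ring

theorem Quad.eval_toCub (p : Quad) : p.toCub.eval e = p.eval e := by
  simp [Quad.toCub, Quad.eval, Cub.eval]

theorem Quad.eval_sum (f : ℕ → Quad) : (Quad.sum f).eval e = ∑ x : Fin 10, (f x.1).eval e := by
  simp [Quad.sum, Quad.eval_add, Fin.sum_univ_succ]; ring

theorem Cub.eval_add (p q : Cub) : (p.add q).eval e = p.eval e + q.eval e := by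
  simp [Cub.add, Cub.eval]; ring

theorem Cub.eval_smul (a : ℕ) (p : Cub) : (p.smul a).eval e = a * p.eval e := by
  simp [Cub.smul, Cub.eval]; ring

theorem Cub.eval_mul (p q : Cub) : (p.mul q).eval e = p.eval e * q.eval e := by
  simp [Cub.mul, Cub.eval, Sext.eval]; ring

theorem Cub.eval_eq_of_beq {p q : Cub} (h : p.beq q = true) : p.eval e = q.eval e := by
  simp only [Cub.beq, Bool.and_eq_true, Nat.beq_eq] at h
  obtain ⟨⟨⟨h0, h1⟩, h2⟩, h3⟩ := h
  simp only [Cub.eval, h0, h1, h2, h3]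

theorem Sext.eval_add (p q : Sext) : (p.add q).eval e = p.eval e + q.eval e := by
  simp [Sext.add, Sext.eval]; ring

theorem Sext.eval_eq_of_beq {p q : Sext} (h : p.beq q = true) : p.eval e = q.eval e := by
  simp only [Sext.beq, Bool.and_eq_true, Nat.beq_eq] at h
  obtain ⟨⟨⟨⟨⟨⟨h0, h1⟩, h2⟩, h3⟩, h4⟩, h5⟩, h6⟩ := h
  simp only [Sext.eval, h0, h1, h2, h3, h4, h5, h6]

/-- For e ≥ 0 all monomials are nonnegative, and the strict comparison of constant terms gives
strictness even at e = 0, that is, for one deck. -/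
theorem Sext.eval_lt_of_lt {p q : Sext} (he : 0 ≤ e) (h : p.lt q = true) :
    p.eval e < q.eval e := by
  simp only [Sext.lt, Bool.and_eq_true, Nat.ble_eq, Nat.blt_eq] at h
  obtain ⟨⟨⟨⟨⟨⟨h0, h1⟩, h2⟩, h3⟩, h4⟩, h5⟩, h6⟩ := h
  unfold Sext.eval
  have h0' : (p.c0 : ℝ) < q.c0 := by exact_mod_cast h0
  have h1' : (p.c1 : ℝ) * e ≤ q.c1 * e := by gcongr
  have h2' : (p.c2 : ℝ) * e ^ 2 ≤ q.c2 * e ^ 2 := by gcongr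
  have h3' : (p.c3 : ℝ) * e ^ 3 ≤ q.c3 * e ^ 3 := by gcongr
  have h4' : (p.c4 : ℝ) * e ^ 4 ≤ q.c4 * e ^ 4 := by gcongr
  have h5' : (p.c5 : ℝ) * e ^ 5 ≤ q.c5 * e ^ 5 := by gcongr
  have h6' : (p.c6 : ℝ) * e ^ 6 ≤ q.c6 * e ^ 6 := by gcongr
  linarith

theorem CubDiff.eval_add (p q : CubDiff) : (p.add q).eval e = p.eval e + q.eval e := by
  simp [CubDiff.add, CubDiff.eval, Cub.eval_add]; ring

theorem CubDiff.eval_sub (p q : CubDiff) : (p.sub q).eval e = p.eval e - q.eval e := by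
  simp [CubDiff.sub, CubDiff.eval, Cub.eval_add]; ring

theorem CubDiff.eval_mulCub (p : CubDiff) (q : Cub) :
    (p.mulCub q).eval e = q.eval e * p.eval e := by
  simp [CubDiff.mulCub, CubDiff.eval, SextDiff.eval, Cub.eval_mul]; ring

theorem CubDiff.eval_eq_of_equiv {p q : CubDiff} (h : p.equiv q = true) :
    p.eval e = q.eval e := by
  have := Cub.eval_eq_of_beq e h
  simp only [Cub.eval_add] at this
  unfold CubDiff.eval
  linarith

theorem SextDiff.eval_add (p q : SextDiff) : (p.add q).eval e = p.eval e + q.eval e := by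
  simp [SextDiff.add, SextDiff.eval, Sext.eval_add]; ring

theorem SextDiff.eval_zero : SextDiff.zero.eval e = 0 := by
  simp [SextDiff.zero, SextDiff.eval]

theorem SextDiff.eval_sum (f : Fin 10 → SextDiff) :
    (SextDiff.sum f).eval e = ∑ x, (f x).eval e := by
  simp [SextDiff.sum, SextDiff.eval_add, Fin.sum_univ_succ]; ring_nf

theorem SextDiff.eval_eq_of_equiv {p q : SextDiff} (h : p.equiv q = true) :
    p.eval e = q.eval e := by
  have := Sext.eval_eq_of_beq e h
  simp only [Sext.eval_add] at this
  unfold SextDiff.eval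
  linarith

end Eval

/-! ### The values of Banker's information states as polynomials in `d - 1` -/

def deckCount (r : ℕ) : ℕ := bif Nat.beq r 0 then 16 else 4

def boolNat (b : Bool) : ℕ := bif b then 1 else 0

def occurrences (r : ℕ) (l : List ℕ) : ℕ :=
  List.rec 0 (fun a _ n => bif Nat.beq r a then Nat.add n 1 else n) l

def sumOver (f : ℕ → ℕ) (l : List ℕ) : ℕ :=
  List.rec 0 (fun a _ n => Nat.add (f a) n) l

/-- `a * d - b` as a polynomial in `d - 1`, if `b ≤ a`. -/
def decksSub (a b : ℕ) : Lin := ⟨Nat.sub a b, a⟩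

/-- `a * d + b` as a polynomial in `d - 1`. -/
def decksAdd (a b : ℕ) : Lin := ⟨Nat.add a b, a⟩

def leftLin (l : List ℕ) (r : ℕ) : Lin := decksSub (deckCount r) (occurrences r l)

def digitAdd (x y : ℕ) : ℕ := Nat.mod (Nat.add x y) 10

def digitSub (x y : ℕ) : ℕ := digitAdd (Nat.sub 10 y) x

def pairQuad (l : List ℕ) (x y : ℕ) : Quad :=
  (leftLin l y).mul (leftLin (y :: l) (digitSub x y))

def wins (f j c : ℕ) : ℕ := boolNat (Nat.blt (digitAdd j c) f)

def loses (f j c : ℕ) : ℕ := boolNat (Nat.blt f (digitAdd j c))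

def standCub (n : ℕ) (l : List ℕ) (x f j : ℕ) : CubDiff :=
  let W := (Quad.sum (pairQuad l x)).mulLin (decksSub 52 n)
  ⟨W.smul (boolNat (Nat.blt j f)), W.smul (boolNat (Nat.blt f j))⟩

/-- The profit over the next card is d times that of a full deck minus that of the cards already
dealt. A dealt card that would make Player lose therefore counts on the positive side, and one that
would make him win on the negative side. The cards of `l` are common to all Player hands of total
`x`, whereas the hand itself needs the separate sum over `y`. -/
def drawCub (l : List ℕ) (x f j : ℕ) : CubDiff :=
  let W := Quad.sum (pairQuad l x)
  ⟨(W.mulLin (decksAdd (Nat.add (Nat.mul 4 f) (Nat.mul 12 (boolNat (Nat.blt j f))))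
      (sumOver (loses f j) l))).add (Quad.sum fun y =>
        (pairQuad l x y).smul (Nat.add (loses f j y) (loses f j (digitSub x y)))).toCub,
   (W.mulLin (decksAdd (Nat.add (Nat.mul 4 (Nat.sub 9 f)) (Nat.mul 12 (boolNat (Nat.blt f j))))
      (sumOver (wins f j) l))).add (Quad.sum fun y =>
        (pairQuad l x y).smul (Nat.add (wins f j y) (wins f j (digitSub x y)))).toCub⟩

/-- `totalValue` as a polynomial. -/
def totalCub (act : Bool) (n : ℕ) (l : List ℕ) (x f j : ℕ) : CubDiff :=
  bif act then drawCub l x f j else standCub n l x f j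

/-! ### The polynomials evaluate to the real quantities of the game. -/

section Bridge

variable {d : ℕ} {e : ℝ}

theorem cast_eq_ite (b : Bool) : (boolNat b : ℝ) = if b = true then 1 else 0 := by
  cases b <;> simp [boolNat]

theorem occurrences_map (l : List (Fin 10)) (r : Fin 10) :
    occurrences r.1 (l.map Fin.val) = l.count r := by
  induction l with
  | nil => rfl
  | cons a l ih =>
    have : occurrences r.1 ((a :: l).map Fin.val) =
      bif Nat.beq r.1 a.1 then Nat.add (occurrences r.1 (l.map Fin.val)) 1
        else occurrences r.1 (l.map Fin.val) := rfl
    rw [this, ih]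
    by_cases h : a = r
    · subst h; simp
    · rw [List.count_cons_of_ne h]
      have : Nat.beq r.1 a.1 = false := by
        rw [Bool.eq_false_iff]; intro h'; exact h (Fin.ext (Nat.eq_of_beq_eq_true h').symm)
      simp [this]

theorem deckCount_eq (r : Fin 10) : deckCount r.1 = if r = 0 then 16 else 4 := by
  revert r; decide

theorem fullShoe_eq (r : Fin 10) : fullShoe d r = deckCount r.1 * d := by
  rw [deckCount_eq, fullShoe]; split_ifs <;> rfl

theorem eval_decksSub (h : (d : ℝ) = e + 1) {a b : ℕ} (hab : b ≤ a) :
    (decksSub a b).eval e = a * d - b := by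
  have : ((Nat.sub a b : ℕ) : ℝ) = a - b := Nat.cast_sub hab
  rw [decksSub, Lin.eval, this, h]; ring

theorem eval_decksAdd (h : (d : ℝ) = e + 1) (a b : ℕ) : (decksAdd a b).eval e = a * d + b := by
  rw [decksAdd, Lin.eval, h]; simp; ring

/-- One deck has at least four cards of each value, so with at most four cards removed the truncated
subtraction in `decksSub` is exact. -/
theorem eval_leftLin (h : (d : ℝ) = e + 1) (l : List (Fin 10)) (hl : l.length ≤ 4) (r : Fin 10) :
    (leftLin (l.map Fin.val) r.1).eval e = cardsLeft d l r := by
  rw [leftLin, eval_decksSub h, cardsLeft, fullShoe_eq, occurrences_map]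
  · push_cast; ring
  · rw [occurrences_map]
    refine (List.count_le_length.trans hl).trans ?_
    revert r; decide

theorem digitAdd_val (x y : Fin 10) : digitAdd x.1 y.1 = (x + y).1 := rfl

theorem digitSub_val (x y : Fin 10) : digitSub x.1 y.1 = (x - y).1 := by
  revert x y; decide

theorem eval_pairQuad (h : (d : ℝ) = e + 1) (l : List (Fin 10)) (hl : l.length ≤ 3)
    (x y : Fin 10) : (pairQuad (l.map Fin.val) x.1 y.1).eval e =
      cardsLeft d l y * cardsLeft d (y :: l) (x - y) := by
  rw [pairQuad, Lin.eval_mul, eval_leftLin h _ (by omega), digitSub_val, ← List.map_cons,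
    eval_leftLin h _ (by simp; omega)]

theorem wins_sub_loses (f j c : Fin 10) :
    (wins f.1 j.1 c.1 : ℝ) - loses f.1 j.1 c.1 = profit f (j + c) := by
  rw [wins, loses, digitAdd_val, cast_eq_ite, cast_eq_ite, profit]
  simp only [Nat.blt_eq, Fin.val_fin_lt]
  rcases lt_trichotomy f (j + c) with h | h | h
  · simp [h, h.not_gt]
  · simp [h]
  · simp [h, h.not_gt]

theorem sumOver_map (g : ℕ → ℕ) (l : List (Fin 10)) :
    sumOver g (l.map Fin.val) = (l.map fun r => g r.1).sum := by
  induction l with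
  | nil => rfl
  | cons a l ih => simp [← ih, sumOver]

theorem sum_count_mul (l : List (Fin 10)) (g : Fin 10 → ℝ) :
    ∑ c, (l.count c : ℝ) * g c = (l.map g).sum := by
  induction l with
  | nil => simp
  | cons a l ih =>
    simp only [List.count_cons, Nat.cast_add, add_mul, Finset.sum_add_distrib, ih, List.map_cons,
      List.sum_cons]
    rw [add_comm]
    congr 1
    simp

/-- As `c` runs through the ten values, so does `j + c`: f of these lie below `f` and 9 - f above,
each with four cards per deck. The twelve further cards of value 0 leave the total at `j`. -/
theorem sum_deckCount_mul_profit (f j : Fin 10) :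
    ∑ c : Fin 10, (deckCount c.1 : ℝ) * profit f (j + c) =
      (4 * f.1 + 12 * boolNat (Nat.blt j.1 f.1) : ℕ) -
        (4 * (9 - f.1) + 12 * boolNat (Nat.blt f.1 j.1) : ℕ) := by
  have key : ∀ f j : Fin 10, ∑ c : Fin 10, (deckCount c.1 : ℤ) * ((wins f.1 j.1 c.1 : ℤ) -
      (loses f.1 j.1 c.1 : ℤ)) = (4 * f.1 + 12 * boolNat (Nat.blt j.1 f.1) : ℕ) -
        (4 * (9 - f.1) + 12 * boolNat (Nat.blt f.1 j.1) : ℕ) := by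
    decide +kernel
  have := congrArg (Int.cast : ℤ → ℝ) (key f j)
  simp only [← wins_sub_loses]
  rw [Int.cast_sum] at this
  simpa only [Int.cast_mul, Int.cast_sub, Int.cast_natCast] using this

theorem outcome_true (l : List (Fin 10)) (f j : Fin 10) :
    outcome d true l f j = d * ∑ c : Fin 10, (deckCount c.1 : ℝ) * profit f (j + c) -
      (l.map fun c => profit f (j + c)).sum := by
  rw [outcome, if_pos rfl, Finset.mul_sum, ← sum_count_mul, ← Finset.sum_sub_distrib]
  refine Finset.sum_congr rfl fun c _ => ?_
  rw [cardsLeft, fullShoe_eq]; push_cast; ring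

theorem eval_drawCub (h : (d : ℝ) = e + 1) (l : List (Fin 10)) (hl : l.length ≤ 3)
    (x f j : Fin 10) :
    (drawCub (l.map Fin.val) x.1 f.1 j.1).eval e = totalValue d true l x f j := by
  have hs : (sumOver (wins f.1 j.1) (l.map Fin.val) : ℝ) -
      sumOver (loses f.1 j.1) (l.map Fin.val) = (l.map fun c => profit f (j + c)).sum := by
    rw [sumOver_map, sumOver_map]
    clear hl
    induction l with
    | nil => simp
    | cons a l ih =>
      simp only [List.map_cons, List.sum_cons, Nat.cast_add]
      rw [← ih, ← wins_sub_loses]; ring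
  have hA := sum_deckCount_mul_profit f j
  simp only [drawCub, CubDiff.eval, Cub.eval_add, Quad.eval_mulLin, Quad.eval_toCub, Quad.eval_sum,
    Quad.eval_smul, eval_decksAdd h, eval_pairQuad h l hl, digitSub_val]
  simp only [totalValue, outcome_true, List.map_cons, List.sum_cons, ← wins_sub_loses f j (_ - _)]
  rw [hA, ← hs]
  simp only [← wins_sub_loses f j]
  simp only [Nat.add_eq, Nat.mul_eq, Nat.sub_eq, mul_sub, mul_add, Finset.sum_sub_distrib,
    Finset.sum_add_distrib, Nat.cast_add, add_mul]
  simp only [← Finset.sum_mul]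
  simp only [mul_comm (Nat.cast (wins _ _ _) : ℝ), mul_comm (Nat.cast (loses _ _ _) : ℝ)]
  ring

theorem boolNat_profit (f j : Fin 10) :
    (boolNat (Nat.blt j.1 f.1) : ℝ) - boolNat (Nat.blt f.1 j.1) = profit f j := by
  have := wins_sub_loses f j 0
  rwa [wins, loses, digitAdd_val, add_zero] at this

theorem eval_standCub (h : (d : ℝ) = e + 1) {n : ℕ} (l : List (Fin 10)) (hl : l.length ≤ 3)
    (hn : n = l.length + 2) (x f j : Fin 10) :
    (standCub n (l.map Fin.val) x.1 f.1 j.1).eval e = totalValue d false l x f j := by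
  simp only [standCub, CubDiff.eval, Cub.eval_smul, Quad.eval_mulLin, Quad.eval_sum,
    eval_pairQuad h l hl, eval_decksSub h (show n ≤ 52 by omega)]
  simp only [totalValue, outcome, Bool.false_eq_true, if_false, ← boolNat_profit, List.length_cons,
    hn, ← Finset.sum_mul]
  push_cast
  ring

theorem eval_totalCub (h : (d : ℝ) = e + 1) {n : ℕ} (act : Bool) (l : List (Fin 10))
    (hl : l.length ≤ 3) (hn : n = l.length + 2) (x f j : Fin 10) :
    (totalCub act n (l.map Fin.val) x.1 f.1 j.1).eval e = totalValue d act l x f j := by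
  cases act
  · exact eval_standCub h l hl hn x f j
  · exact eval_drawCub h l hl x f j

end Bridge

/-- The part of `restrictedValue` that does not depend on Player's strategy, as a polynomial. -/
def fixedCub (act : Bool) (a b : Fin 10) (k : Option (Fin 10)) : CubDiff :=
  Option.rec
    ((totalCub act 4 [b.1, a.1] 6 6 (digitAdd a.1 b.1)).add
      (totalCub act 4 [b.1, a.1] 7 7 (digitAdd a.1 b.1)))
    (fun k => (((totalCub act 5 [k.1, b.1, a.1] 0 (digitAdd 0 k.1) (digitAdd a.1 b.1)).add
      (totalCub act 5 [k.1, b.1, a.1] 1 (digitAdd 1 k.1) (digitAdd a.1 b.1))).add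
      ((totalCub act 5 [k.1, b.1, a.1] 2 (digitAdd 2 k.1) (digitAdd a.1 b.1)).add
      (totalCub act 5 [k.1, b.1, a.1] 3 (digitAdd 3 k.1) (digitAdd a.1 b.1)))).add
      (totalCub act 5 [k.1, b.1, a.1] 4 (digitAdd 4 k.1) (digitAdd a.1 b.1))) k

/-- The part of `restrictedValue` that comes from Player's two-card total 5, as a polynomial. -/
def freeCub (act : Bool) (a b : Fin 10) (k : Option (Fin 10)) : CubDiff :=
  Option.rec (totalCub act 4 [b.1, a.1] 5 5 (digitAdd a.1 b.1))
    (fun k => totalCub act 5 [k.1, b.1, a.1] 5 (digitAdd 5 k.1) (digitAdd a.1 b.1)) k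

/-- The weight of an information state, for both orders of Banker's cards, as a polynomial. -/
def weightCub (a b : Fin 10) (k : Option (Fin 10)) : Cub :=
  Cub.smul (bif Nat.beq a.1 b.1 then 1 else 2) (((leftLin [] a.1).mul (leftLin [a.1] b.1)).mulLin
    (Option.rec (decksSub 52 5) (fun k => leftLin [b.1, a.1] k.1) k))

def fixedGain (a b : Fin 10) (k : Option (Fin 10)) : CubDiff :=
  (fixedCub true a b k).sub (fixedCub false a b k)

def freeGain (a b : Fin 10) (k : Option (Fin 10)) : CubDiff :=
  (freeCub true a b k).sub (freeCub false a b k)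

/-- The denominator of `pOpt d`. -/
def pDen : Cub := ⟨2394, 7586, 8008, 2816⟩

/-- The numerator of `pOpt d`. -/
def pNum : Cub := ⟨1771, 5804, 6336, 2304⟩

/-- The difference `pDen - pNum`. -/
def pNumCompl : Cub := ⟨623, 1782, 1672, 512⟩

/-- Player's gain if Banker draws, when Player draws on 5 with probability `pOpt d`, up to a positive
factor. -/
def mixedGain (a b : Fin 10) (k : Option (Fin 10)) : SextDiff :=
  ((fixedGain a b k).mulCub pDen).add
    ((freeGain a b k).mulCub (Option.rec pNumCompl (fun _ => pNum) k))

/-- The information states at which Banker's move depends on the number of decks. -/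
def deckDependent : List ((Fin 10 × Fin 10) × Option (Fin 10)) :=
  [((4, 9), some 8), ((6, 8), some 1), ((7, 7), some 1), ((0, 5), some 4), ((7, 8), some 4),
    ((1, 4), some 4), ((2, 3), some 4), ((6, 9), some 4), ((3, 3), some 6)]

/-- Banker's move at the other information states. -/
def baseDraws (j : Fin 10 × Fin 10) (k : Option (Fin 10)) : Bool :=
  tableDraws 5 j k && !decide ((j, k) ∈ deckDependent)

/-- Away from the exceptional information states, `mixedGain` has the sign that the table prescribes. -/
def signOK (a b : Fin 10) (k : Option (Fin 10)) : Bool :=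
  decide (((a, b), k) ∈ ((0, 6), none) :: deckDependent) ||
    bif tableDraws 5 (a, b) k then (mixedGain a b k).pos.lt (mixedGain a b k).neg
      else (mixedGain a b k).neg.lt (mixedGain a b k).pos

def isHand (a b : Fin 10) : Bool := Nat.ble a.1 b.1 && Nat.ble (digitAdd a.1 b.1) 7

def handSignOK (a b : Fin 10) : Bool :=
  !isHand a b || (signOK a b none && decide (∀ k, signOK a b (some k) = true))

/-- The sum over Banker's hands that are not naturals. -/
def sumHands (f : Fin 10 → Fin 10 → SextDiff) : SextDiff :=
  SextDiff.sum fun a => SextDiff.sum fun b => bif isHand a b then f a b else SextDiff.zero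

/-- The payoff when Banker follows `baseDraws`, as far as it does not depend on Player's strategy. -/
def fixedTotal : SextDiff :=
  sumHands fun a b =>
    ((fixedCub (baseDraws (a, b) none) a b none).mulCub (weightCub a b none)).add
      (SextDiff.sum fun k =>
        (fixedCub (baseDraws (a, b) (some k)) a b (some k)).mulCub (weightCub a b (some k)))

/-- What is added to `fixedTotal` if Player draws on 5. -/
def freeTotalDraw : SextDiff :=
  sumHands fun a b => SextDiff.sum fun k =>
    (freeCub (baseDraws (a, b) (some k)) a b (some k)).mulCub (weightCub a b (some k))

/-- What is added to `fixedTotal` if Player stands on 5. -/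
def freeTotalStand : SextDiff :=
  sumHands fun a b => (freeCub (baseDraws (a, b) none) a b none).mulCub (weightCub a b none)

/-! ### Contributions of single information states and the effect of Banker's move. -/

section InformationStates

variable {d : ℕ} {e : ℝ}

theorem sum_fin_ten (f : Fin 10 → ℝ) :
    ∑ x, f x = f 0 + f 1 + f 2 + f 3 + f 4 + f 5 + f 6 + f 7 + f 8 + f 9 := by
  simp only [Fin.sum_univ_succ, Fin.sum_univ_zero]
  norm_num [← add_assoc]
  rfl

/-- Player's choice matters only at total 5: that total is compatible with a third card exactly if
he draws on it, and with its absence exactly if he stands. -/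
theorem restrictedValue_eq (h : (d : ℝ) = e + 1) (u act : Bool) (a b : Fin 10)
    (k : Option (Fin 10)) :
    restrictedValue d (Consistent u k) act a b k = (fixedCub act a b k).eval e +
      if u = k.isSome then (freeCub act a b k).eval e else 0 := by
  cases k with
  | none =>
    have key (x : Fin 10) : totalValue d act (infoCards a b none) x (x + thirdCard none) (a + b) =
        (totalCub act 4 [b.1, a.1] x.1 x.1 (digitAdd a.1 b.1)).eval e := by
      have := eval_totalCub h act (infoCards a b none) (by simp [infoCards]) (n := 4) rfl x x (a + b)
      rw [thirdCard, add_zero, ← this]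
      rfl
    simp only [restrictedValue, key, sum_fin_ten]
    have c (x : Fin 10) : Consistent u none x ↔ (x = 6 ∨ x = 7 ∨ (x = 5 ∧ u = false)) := by
      revert x u; decide
    simp only [c]
    simp only [fixedCub, freeCub, CubDiff.eval_add]
    cases u <;> simp
    ring
  | some k =>
    have key (x : Fin 10) :
        totalValue d act (infoCards a b (some k)) x (x + thirdCard (some k)) (a + b) =
        (totalCub act 5 [k.1, b.1, a.1] x.1 (digitAdd x.1 k.1) (digitAdd a.1 b.1)).eval e := by
      have := eval_totalCub h act (infoCards a b (some k)) (by simp [infoCards]) (n := 5) rfl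
        x (x + k) (a + b)
      rw [thirdCard, ← this]
      rfl
    simp only [restrictedValue, key, sum_fin_ten]
    have c (x : Fin 10) : Consistent u (some k) x ↔ (x < 5 ∨ (x = 5 ∧ u = true)) := by
      rw [Consistent]
      simp only [ne_eq, reduceCtorEq, not_false_eq_true, iff_true]
      revert x u; decide
    simp only [c]
    simp only [fixedCub, freeCub, CubDiff.eval_add]
    cases u <;> simp <;> ring

theorem cardsLeft_pos (hd : 1 ≤ d) {l : List (Fin 10)} (hl : l.length ≤ 3) (r : Fin 10) :
    0 < cardsLeft d l r := by
  have h1 : l.count r ≤ 3 := List.count_le_length.trans hl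
  have h2 : 4 ≤ fullShoe d r := by rw [fullShoe]; split_ifs <;> omega
  have : (l.count r : ℝ) < fullShoe d r := by exact_mod_cast h1.trans_lt h2
  rw [cardsLeft]; linarith

/-- Every information state really occurs, even with one deck. Otherwise Banker's move there would
be irrelevant and his optimal strategy not unique. -/
theorem infoWeight_pos (hd : 1 ≤ d) (a b : Fin 10) (k : Option (Fin 10)) :
    0 < infoWeight d a b k := by
  have h5 : (0 : ℝ) < 52 * d - 5 := by
    have : (1 : ℝ) ≤ d := by exact_mod_cast hd
    linarith
  have hw : 0 < (dealWeight d [b, a] : ℝ) := by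
    rw [cast_dealWeight_cons, cast_dealWeight_cons, dealWeight_nil, Nat.cast_one, one_mul]
    exact mul_pos (cardsLeft_pos hd (by simp) _) (cardsLeft_pos hd (by simp) _)
  cases k with
  | none => simpa [infoWeight, infoCards] using mul_pos hw h5
  | some k =>
    simp only [infoWeight, infoCards, cast_dealWeight_cons d [b, a] k]
    simpa using mul_pos hw (cardsLeft_pos hd (by simp) k)

theorem eval_weightCub (h : (d : ℝ) = e + 1) (a b : Fin 10) (k : Option (Fin 10)) :
    (weightCub a b k).eval e = orders a b * infoWeight d a b k := by
  have ho : (bif Nat.beq a.1 b.1 then 1 else 2) = orders a b := by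
    revert a b; decide
  have h0 := eval_leftLin h [] (by simp) a
  have h1 := eval_leftLin h [a] (by simp) b
  rw [weightCub, ho, Cub.eval_smul, Quad.eval_mulLin, Lin.eval_mul]
  simp only [List.map_nil, List.map_cons] at h0 h1
  rw [h0, h1]
  cases k with
  | none =>
    rw [eval_decksSub h (by norm_num), infoWeight, infoCards, cast_dealWeight_cons,
      cast_dealWeight_cons, dealWeight_nil]
    simp
  | some k =>
    have h2 := eval_leftLin h [b, a] (by simp) k
    simp only [List.map_nil, List.map_cons] at h2
    simp only [h2, infoWeight, infoCards, cast_dealWeight_cons, dealWeight_nil]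
    simp

theorem orders_pos (a b : Fin 10) : 0 < (orders a b : ℝ) := by
  rw [orders]; split_ifs <;> norm_num

theorem weightCub_pos (hd : 1 ≤ d) (h : (d : ℝ) = e + 1) (a b : Fin 10) (k : Option (Fin 10)) :
    0 < (weightCub a b k).eval e := by
  rw [eval_weightCub h]
  exact mul_pos (orders_pos a b) (infoWeight_pos hd a b k)

/-- The contribution of an information state to the payoff, times `sixDeals d`. -/
noncomputable def contribution (d : ℕ) (u act : Bool) (a b : Fin 10) (k : Option (Fin 10)) : ℝ :=
  orders a b * infoValue d u act a b k

theorem contribution_eq (h : (d : ℝ) = e + 1) (u act : Bool) (a b : Fin 10)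
    (k : Option (Fin 10)) :
    contribution d u act a b k = (weightCub a b k).eval e * ((fixedCub act a b k).eval e +
      if u = k.isSome then (freeCub act a b k).eval e else 0) := by
  rw [contribution, infoValue, restrictedValue_eq h, eval_weightCub h]; ring

theorem contribution_sub (h : (d : ℝ) = e + 1) (u : Bool) (a b : Fin 10)
    (k : Option (Fin 10)) :
    contribution d u true a b k - contribution d u false a b k =
      (weightCub a b k).eval e * ((fixedGain a b k).eval e +
        if u = k.isSome then (freeGain a b k).eval e else 0) := by
  rw [contribution_eq h, contribution_eq h, fixedGain, freeGain, CubDiff.eval_sub, CubDiff.eval_sub]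
  split_ifs <;> ring

theorem pDen_eval_pos (he : 0 ≤ e) : 0 < pDen.eval e := by
  unfold pDen Cub.eval; push_cast; positivity

theorem pOpt_eq (hd : 1 ≤ d) (h : (d : ℝ) = e + 1) : pOpt d = pNum.eval e / pDen.eval e := by
  have he : 0 ≤ e := by
    have : (1 : ℝ) ≤ d := by exact_mod_cast hd
    linarith
  simp only [pOpt, h, pNum, pDen, Cub.eval]
  push_cast
  congr 1 <;> ring

theorem pNumCompl_eval : pNumCompl.eval e = pDen.eval e - pNum.eval e := by
  simp only [pNum, pDen, pNumCompl, Cub.eval]; push_cast; ring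

theorem eval_mixedGain (a b : Fin 10) (k : Option (Fin 10)) :
    (mixedGain a b k).eval e = pDen.eval e * (fixedGain a b k).eval e +
      (if k.isSome = true then pNum.eval e else pDen.eval e - pNum.eval e) *
        (freeGain a b k).eval e := by
  rw [mixedGain, SextDiff.eval_add, CubDiff.eval_mulCub, CubDiff.eval_mulCub]
  cases k <;> simp [pNumCompl_eval]

/-- The contribution of an information state when Player draws on 5 with probability `pOpt d`. -/
noncomputable def mixedContribution (d : ℕ) (act : Bool) (a b : Fin 10) (k : Option (Fin 10)) : ℝ :=
  pOpt d * contribution d true act a b k + (1 - pOpt d) * contribution d false act a b k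

theorem mixedContribution_sub (hd : 1 ≤ d) (h : (d : ℝ) = e + 1) (a b : Fin 10)
    (k : Option (Fin 10)) :
    mixedContribution d true a b k - mixedContribution d false a b k =
      (weightCub a b k).eval e / pDen.eval e * (mixedGain a b k).eval e := by
  have he : 0 ≤ e := by
    have : (1 : ℝ) ≤ d := by exact_mod_cast hd
    linarith
  have hpos := (pDen_eval_pos he).ne'
  have h1 := contribution_sub h true a b k
  have h0 := contribution_sub h false a b k
  have : mixedContribution d true a b k - mixedContribution d false a b k =
      pOpt d * (contribution d true true a b k - contribution d true false a b k) +
      (1 - pOpt d) * (contribution d false true a b k - contribution d false false a b k) := by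
    unfold mixedContribution; ring
  rw [this, h1, h0, eval_mixedGain, pOpt_eq hd h]
  cases k <;> simp <;> field_simp <;> ring

theorem isHand_iff (a b : Fin 10) : isHand a b = true ↔ a ≤ b ∧ a + b ≤ 7 := by
  rw [isHand, Bool.and_eq_true, Nat.ble_eq, Nat.ble_eq, digitAdd_val]; rfl

theorem sum_bankerInfo (g : Fin 10 → Fin 10 → Option (Fin 10) → ℝ) :
    ∑ i : BankerInfo, g i.1.1.1 i.1.1.2 i.2 =
      ∑ a, ∑ b, if isHand a b = true then ∑ k, g a b k else 0 := by
  rw [Fintype.sum_prod_type]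
  simp only [isHand_iff]
  rw [← Fintype.sum_prod_type' (f := fun a b : Fin 10 =>
    if a ≤ b ∧ a + b ≤ 7 then ∑ k, g a b k else 0), ← Finset.sum_filter]
  exact (Finset.sum_subtype _ (by simp) fun p : Fin 10 × Fin 10 => ∑ k, g p.1 p.2 k).symm

theorem eval_sumHands (f : Fin 10 → Fin 10 → SextDiff) :
    (sumHands f).eval e = ∑ a, ∑ b, if isHand a b = true then (f a b).eval e else 0 := by
  rw [sumHands, SextDiff.eval_sum]
  refine Finset.sum_congr rfl fun a _ => ?_
  rw [SextDiff.eval_sum]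
  refine Finset.sum_congr rfl fun b _ => ?_
  cases isHand a b <;> simp [SextDiff.eval_zero]

theorem sum_contribution_base (h : (d : ℝ) = e + 1) (u : Bool) :
    ∑ i : BankerInfo, contribution d u (baseDraws i.1.1 i.2) i.1.1.1 i.1.1.2 i.2 =
      fixedTotal.eval e + if u = true then freeTotalDraw.eval e else freeTotalStand.eval e := by
  rw [sum_bankerInfo fun a b k => contribution d u (baseDraws (a, b) k) a b k]
  rw [fixedTotal, freeTotalDraw, freeTotalStand, eval_sumHands, eval_sumHands, eval_sumHands]
  simp only [SextDiff.eval_add, CubDiff.eval_mulCub, SextDiff.eval_sum, Fintype.sum_option,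
    contribution_eq h]
  cases u
  all_goals
    simp only [Bool.false_eq_true, if_false, if_true, ← Finset.sum_add_distrib, Option.isSome_none,
      Option.isSome_some, Bool.true_eq_false]
    refine Finset.sum_congr rfl fun a _ => Finset.sum_congr rfl fun b _ => ?_
    split_ifs
    · simp only [mul_add, Finset.sum_add_distrib, add_zero]; ring
    · simp

end InformationStates

/-! ### Results of the evaluations -/

/-- A finite comparison of coefficients in powers of d - 1 that settles the sign for all d at once.
-/
theorem handSignOK_all : ∀ a b, handSignOK a b = true := by decide +kernel

theorem fixedTotal_equiv : fixedTotal.equiv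
    ⟨⟨0, 0, 0, 0, 0, 0, 0⟩, ⟨207128192, 1294561504, 3370048800, 4677237696, 3650106624, 1518656512, 263172096⟩⟩ = true := by
  decide +kernel

theorem freeTotalDraw_equiv : freeTotalDraw.equiv
    ⟨⟨15712512, 98004736, 254534912, 352360704, 274233856, 113776640, 19660800⟩, ⟨0, 0, 0, 0, 0, 0, 0⟩⟩ = true := by
  decide +kernel

theorem freeTotalStand_equiv : freeTotalStand.equiv
    ⟨⟨0, 0, 0, 0, 0, 0, 0⟩, ⟨22890880, 142800512, 370533504, 511828864, 396919808, 163829760, 28114944⟩⟩ = true := by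
  decide +kernel

/-- Weight, `fixedGain` and `freeGain` at the deck-dependent information states. -/
def gainTable : List (((Fin 10 × Fin 10) × Option (Fin 10)) × Cub × CubDiff × CubDiff) := [
    (((4, 9), some 8), ⟨128, 384, 384, 128⟩,
      ⟨⟨1542, 6232, 8080, 3392⟩, ⟨0, 0, 0, 0⟩⟩, ⟨⟨0, 0, 0, 0⟩, ⟨2824, 8744, 8992, 3072⟩⟩),
    (((6, 8), some 1), ⟨128, 384, 384, 128⟩,
      ⟨⟨3682, 13800, 16944, 6848⟩, ⟨0, 0, 0, 0⟩⟩, ⟨⟨0, 0, 0, 0⟩, ⟨6096, 19344, 20416, 7168⟩⟩),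
    (((7, 7), some 1), ⟨48, 160, 176, 64⟩,
      ⟨⟨3302, 13144, 16688, 6848⟩, ⟨0, 0, 0, 0⟩⟩, ⟨⟨0, 0, 0, 0⟩, ⟨6096, 19344, 20416, 7168⟩⟩),
    (((0, 5), some 4), ⟨512, 1536, 1536, 512⟩,
      ⟨⟨1080, 2288, 1264, 64⟩, ⟨0, 0, 0, 0⟩⟩, ⟨⟨0, 0, 0, 0⟩, ⟨606, 2176, 2592, 1024⟩⟩),
    (((7, 8), some 4), ⟨128, 384, 384, 128⟩,
      ⟨⟨802, 1800, 1072, 64⟩, ⟨0, 0, 0, 0⟩⟩, ⟨⟨0, 0, 0, 0⟩, ⟨678, 2344, 2688, 1024⟩⟩),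
    (((1, 4), some 4), ⟨96, 320, 352, 128⟩,
      ⟨⟨4582, 10184, 5680, 64⟩, ⟨0, 0, 0, 0⟩⟩, ⟨⟨0, 0, 0, 0⟩, ⟨460, 1880, 2432, 1024⟩⟩),
    (((2, 3), some 4), ⟨128, 384, 384, 128⟩,
      ⟨⟨5734, 12560, 6896, 64⟩, ⟨0, 0, 0, 0⟩⟩, ⟨⟨0, 0, 0, 0⟩, ⟨678, 2344, 2688, 1024⟩⟩),
    (((6, 9), some 4), ⟨128, 384, 384, 128⟩,
      ⟨⟨1190, 2596, 1472, 64⟩, ⟨0, 0, 0, 0⟩⟩, ⟨⟨0, 0, 0, 0⟩, ⟨678, 2344, 2688, 1024⟩⟩),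
    (((3, 3), some 6), ⟨48, 160, 176, 64⟩,
      ⟨⟨0, 0, 0, 0⟩, ⟨116, 3100, 6368, 3392⟩⟩, ⟨⟨2592, 8256, 8736, 3072⟩, ⟨0, 0, 0, 0⟩⟩)]

theorem gainTable_spec : ∀ x ∈ gainTable,
    (weightCub x.1.1.1 x.1.1.2 x.1.2).beq x.2.1 = true ∧
    (fixedGain x.1.1.1 x.1.1.2 x.1.2).equiv x.2.2.1 = true ∧
    (freeGain x.1.1.1 x.1.1.2 x.1.2).equiv x.2.2.2 = true := by
  decide +kernel

/-- These coefficients are those of -4 (`pDen` - `pNum`), and those of `freeGain` at the same state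
are 4 `pDen`. Banker is thus indifferent exactly if Player stands on 5 with probability (`pDen` -
`pNum`) / `pDen`, which is the origin of `pOpt`. -/
theorem fixedGain_mixed : (fixedGain 0 6 none).equiv
    ⟨⟨0, 0, 0, 0⟩, ⟨2492, 7128, 6688, 2048⟩⟩ = true := by
  decide +kernel

theorem freeGain_mixed : (freeGain 0 6 none).equiv
    ⟨⟨9576, 30344, 32032, 11264⟩, ⟨0, 0, 0, 0⟩⟩ = true := by
  decide +kernel

theorem weightCub_mixed : (weightCub 0 6 none).beq ⟨6016, 18688, 19328, 6656⟩ = true := by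
  decide +kernel

theorem map_fst_gainTable : gainTable.map Prod.fst = deckDependent := rfl

/-- The number 5 is an arbitrary representative, since the table is constant in d off the listed
states. -/
theorem tableDraws_eq_five (d : ℕ) (j : Fin 10 × Fin 10) (k : Option (Fin 10))
    (h : (j, k) ∉ deckDependent) : tableDraws d j k = tableDraws 5 j k := by
  simp only [deckDependent, List.mem_cons, Prod.mk.injEq, List.not_mem_nil, or_false, not_or] at h
  obtain ⟨h1, h2, h3, h4, h5, h6, h7, h8, h9⟩ := h
  by_cases k8 : k = some 8
  · subst k8
    have : j ≠ (4, 9) := fun h => h1 ⟨h, rfl⟩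
    simp [tableDraws, this]
  by_cases k1 : k = some 1
  · subst k1
    have a1 : j ≠ (6, 8) := fun h => h2 ⟨h, rfl⟩
    have a2 : j ≠ (7, 7) := fun h => h3 ⟨h, rfl⟩
    simp [tableDraws, a1, a2]
  by_cases k4 : k = some 4
  · subst k4
    have a1 : j ≠ (0, 5) := fun h => h4 ⟨h, rfl⟩
    have a2 : j ≠ (7, 8) := fun h => h5 ⟨h, rfl⟩
    have a3 : j ≠ (1, 4) := fun h => h6 ⟨h, rfl⟩
    have a4 : j ≠ (2, 3) := fun h => h7 ⟨h, rfl⟩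
    have a5 : j ≠ (6, 9) := fun h => h8 ⟨h, rfl⟩
    simp [tableDraws, a1, a2, a3, a4, a5]
  by_cases k6 : k = some 6
  · subst k6
    have a1 : j ≠ (3, 3) := fun h => h9 ⟨h, rfl⟩
    simp [tableDraws, a1]
  simp [tableDraws, k8, k1, k4, k6]

theorem isHand_of_mem_deckDependent : ∀ p ∈ deckDependent, isHand p.1.1 p.1.2 = true := by
  decide +kernel

theorem nodup_deckDependent : deckDependent.Nodup := by decide +kernel

/-! ### The deck-dependent states and the payoffs of Banker's two strategies. -/

section Final

variable {d : ℕ} {e : ℝ}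

theorem gain_of_mem_gainTable (h : (d : ℝ) = e + 1) (u : Bool)
    {x : ((Fin 10 × Fin 10) × Option (Fin 10)) × Cub × CubDiff × CubDiff} (hx : x ∈ gainTable) :
    contribution d u true x.1.1.1 x.1.1.2 x.1.2 - contribution d u false x.1.1.1 x.1.1.2 x.1.2 =
      x.2.1.eval e * (x.2.2.1.eval e + if u = x.1.2.isSome then x.2.2.2.eval e else 0) := by
  obtain ⟨hw, hf, hg⟩ := gainTable_spec x hx
  rw [contribution_sub h, Cub.eval_eq_of_beq e hw, CubDiff.eval_eq_of_equiv e hf,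
    CubDiff.eval_eq_of_equiv e hg]

theorem gain_mixed (h : (d : ℝ) = e + 1) (u : Bool) :
    contribution d u true 0 6 none - contribution d u false 0 6 none =
      (6016 + 18688 * e + 19328 * e ^ 2 + 6656 * e ^ 3) *
        (4 * if u = true then pNum.eval e - pDen.eval e else pNum.eval e) := by
  rw [contribution_sub h, Cub.eval_eq_of_beq e weightCub_mixed,
    CubDiff.eval_eq_of_equiv e fixedGain_mixed, CubDiff.eval_eq_of_equiv e freeGain_mixed]
  cases u
  all_goals
    simp only [Option.isSome_none, Bool.true_eq_false, Bool.false_eq_true, if_true, if_false,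
      Cub.eval, CubDiff.eval, pNum, pDen]
    push_cast
    ring

/-- The payoff for the table, times `sixDeals d`, as a polynomial in `d - 1`. -/
theorem sum_contribution_table (h : (d : ℝ) = e + 1) (u : Bool) :
    ∑ i : BankerInfo, contribution d u (tableDraws d i.1.1 i.2) i.1.1.1 i.1.1.2 i.2 =
      (fixedTotal.eval e + if u = true then freeTotalDraw.eval e else freeTotalStand.eval e) +
      (gainTable.map fun x => if tableDraws d x.1.1 x.1.2 = true then
        x.2.1.eval e * (x.2.2.1.eval e + if u = x.1.2.isSome then x.2.2.2.eval e else 0)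
          else 0).sum := by
  set g : (Fin 10 × Fin 10) × Option (Fin 10) → ℝ := fun p =>
    if tableDraws d p.1 p.2 = true then
      contribution d u true p.1.1 p.1.2 p.2 - contribution d u false p.1.1 p.1.2 p.2 else 0 with hg
  have e1 : (gainTable.map fun x => if tableDraws d x.1.1 x.1.2 = true then
        x.2.1.eval e * (x.2.2.1.eval e + if u = x.1.2.isSome then x.2.2.2.eval e else 0)
          else 0) = deckDependent.map g := by
    rw [← map_fst_gainTable, List.map_map]
    refine List.map_congr_left fun x hx => ?_
    simp only [hg, Function.comp_apply, gain_of_mem_gainTable h u hx]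
  -- The list has no repetitions and contains only hands that are not naturals, so its sum is a sum
  -- over information states.
  have e2 : (deckDependent.map g).sum = ∑ i : BankerInfo,
      if ((i.1.1.1, i.1.1.2), i.2) ∈ deckDependent then g ((i.1.1.1, i.1.1.2), i.2) else 0 := by
    rw [sum_bankerInfo fun a b k => if ((a, b), k) ∈ deckDependent then g ((a, b), k) else 0]
    have : ∀ a b : Fin 10, (if isHand a b = true then
        ∑ k, (if ((a, b), k) ∈ deckDependent then g ((a, b), k) else 0) else 0) =
        ∑ k, if ((a, b), k) ∈ deckDependent then g ((a, b), k) else 0 := by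
      intro a b
      split_ifs with hab
      · rfl
      · symm
        refine Finset.sum_eq_zero fun k _ => if_neg fun hk => hab ?_
        exact isHand_of_mem_deckDependent _ hk
    simp only [this]
    rw [← List.sum_toFinset g nodup_deckDependent, ← Fintype.sum_prod_type'
      (f := fun a b : Fin 10 => ∑ k, if ((a, b), k) ∈ deckDependent then g ((a, b), k) else 0),
      ← Fintype.sum_prod_type' (f := fun (j : Fin 10 × Fin 10) (k : Option (Fin 10)) =>
        if ((j.1, j.2), k) ∈ deckDependent then g ((j.1, j.2), k) else 0)]
    simp only [← List.mem_toFinset (l := deckDependent), Finset.sum_ite_mem, Finset.univ_inter,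
      Prod.mk.eta]
  rw [e1, e2, ← sum_contribution_base h, ← Finset.sum_add_distrib]
  refine Finset.sum_congr rfl fun i _ => ?_
  simp only [Prod.mk.eta, hg, baseDraws]
  by_cases hi : (i.1.1, i.2) ∈ deckDependent
  · cases tableDraws d i.1.1 i.2 <;> simp [hi]
  · rw [tableDraws_eq_five d _ _ hi]
    simp [hi]

theorem decide_mem_bankerS (i : BankerInfo) :
    decide (i ∈ bankerS d) = tableDraws d i.1.1 i.2 := by
  simp [bankerS]

/-- The information state in which Banker mixes. -/
def mixedInfo : BankerInfo := (⟨(0, 6), by decide⟩, none)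

theorem tableDraws_mixed : tableDraws d (0, 6) none = false := by
  simp [tableDraws]

theorem mixedInfo_notMem : mixedInfo ∉ bankerS d := by
  simp [bankerS, mixedInfo, tableDraws_mixed]

theorem payoff_bankerS (hd : 1 ≤ d) (u : Bool) : baccaraPayoff d u (bankerS d) * sixDeals d =
    ∑ i : BankerInfo, contribution d u (tableDraws d i.1.1 i.2) i.1.1.1 i.1.1.2 i.2 := by
  rw [baccaraPayoff_eq hd]
  simp only [decide_mem_bankerS, contribution]

theorem payoff_bankerD (hd : 1 ≤ d) (u : Bool) : baccaraPayoff d u (bankerD d) * sixDeals d =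
    baccaraPayoff d u (bankerS d) * sixDeals d +
      (contribution d u true 0 6 none - contribution d u false 0 6 none) := by
  have e1 : baccaraPayoff d u (bankerD d) * sixDeals d - baccaraPayoff d u (bankerS d) * sixDeals d =
      ∑ i : BankerInfo, if i = mixedInfo then
        contribution d u true 0 6 none - contribution d u false 0 6 none else 0 := by
    rw [baccaraPayoff_eq hd, baccaraPayoff_eq hd, ← Finset.sum_sub_distrib]
    refine Finset.sum_congr rfl fun i _ => ?_
    have hD : i ∈ bankerD d ↔ i = mixedInfo ∨ i ∈ bankerS d := Finset.mem_insert
    by_cases hi : i = mixedInfo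
    · have hS : mixedInfo ∉ bankerS d := mixedInfo_notMem
      subst hi
      simp only [hD, hS, true_or, decide_true, decide_false, if_true]
      rfl
    · simp [hD, hi]
  rw [Finset.sum_ite_eq'] at e1
  simp only [Finset.mem_univ, if_true] at e1
  linarith

theorem tableDraws_deckDependent (d : ℕ) :
    tableDraws d (4, 9) (some 8) = decide (d = 1) ∧
    tableDraws d (6, 8) (some 1) = decide (d ≤ 2) ∧
    tableDraws d (7, 7) (some 1) = decide (d ≤ 2) ∧
    tableDraws d (0, 5) (some 4) = decide (2 ≤ d) ∧
    tableDraws d (7, 8) (some 4) = decide (2 ≤ d) ∧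
    tableDraws d (1, 4) (some 4) = decide (8 ≤ d) ∧
    tableDraws d (2, 3) (some 4) = decide (10 ≤ d) ∧
    tableDraws d (6, 9) (some 4) = decide (3 ≤ d) ∧
    tableDraws d (3, 3) (some 6) = decide (4 ≤ d) := by
  refine ⟨?_, ?_, ?_, ?_, ?_, ?_, ?_, ?_, ?_⟩ <;> simp [tableDraws]

/-- The sign changes once, at a threshold depending on the state. From the threshold on, the
substitution d = threshold + t leaves a polynomial in t whose coefficients have one sign; the
finitely many smaller d are evaluated numerically. -/
theorem deckDependent_sign (hd : 1 ≤ d) (h : (d : ℝ) = e + 1) : ∀ x ∈ gainTable,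
    if tableDraws d x.1.1 x.1.2 = true then
      pDen.eval e * x.2.2.1.eval e + pNum.eval e * x.2.2.2.eval e < 0
    else 0 < pDen.eval e * x.2.2.1.eval e + pNum.eval e * x.2.2.2.eval e := by
  have he : e = d - 1 := by linarith
  subst he
  clear h
  obtain ⟨t1, t2, t3, t4, t5, t6, t7, t8, t9⟩ := tableDraws_deckDependent d
  simp only [gainTable, List.forall_mem_cons, t1, t2, t3, t4, t5, t6, t7, t8, t9,
    decide_eq_true_eq, pDen, pNum, Cub.eval, CubDiff.eval, List.not_mem_nil, false_imp_iff,
    implies_true, and_true]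
  push_cast
  refine ⟨?_, ?_, ?_, ?_, ?_, ?_, ?_, ?_, ?_⟩
  all_goals split_ifs with hc
  · subst hc; norm_num
  · obtain ⟨t, rfl⟩ := Nat.exists_eq_add_of_le (show 2 ≤ d by omega)
    push_cast; ring_nf; positivity
  · interval_cases d <;> norm_num
  · obtain ⟨t, rfl⟩ := Nat.exists_eq_add_of_le (show 3 ≤ d by omega)
    push_cast; ring_nf; positivity
  · interval_cases d <;> norm_num
  · obtain ⟨t, rfl⟩ := Nat.exists_eq_add_of_le (show 3 ≤ d by omega)
    push_cast; ring_nf; positivity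
  all_goals first
    | (interval_cases d <;> norm_num)
    | (obtain ⟨t, rfl⟩ := Nat.exists_eq_add_of_le hc
       rw [← neg_pos]; push_cast; ring_nf; positivity)

end Final

/-! ### Banker's best replies to Player's mixture. -/

section Optimality

variable {d : ℕ} {e : ℝ}

theorem mixedContribution_sign (hd : 1 ≤ d) (i : BankerInfo) (hi : i ≠ mixedInfo) :
    if tableDraws d i.1.1 i.2 = true then
      mixedContribution d true i.1.1.1 i.1.1.2 i.2 < mixedContribution d false i.1.1.1 i.1.1.2 i.2
    else
      mixedContribution d false i.1.1.1 i.1.1.2 i.2 <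
        mixedContribution d true i.1.1.1 i.1.1.2 i.2 := by
  obtain ⟨e, h⟩ : ∃ e : ℝ, (d : ℝ) = e + 1 := ⟨d - 1, by ring⟩
  have he : 0 ≤ e := by
    have : (1 : ℝ) ≤ d := by exact_mod_cast hd
    linarith
  obtain ⟨⟨⟨a, b⟩, hab⟩, k⟩ := i
  dsimp only at hab hi ⊢
  have hsub := mixedContribution_sub hd h a b k
  have hpos : 0 < (weightCub a b k).eval e / pDen.eval e :=
    div_pos (weightCub_pos hd h a b k) (pDen_eval_pos he)
  suffices hs : if tableDraws d (a, b) k = true then (mixedGain a b k).eval e < 0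
      else 0 < (mixedGain a b k).eval e by
    split_ifs at hs ⊢
    · have := mul_neg_of_pos_of_neg hpos hs
      linarith
    · have := mul_pos hpos hs
      linarith
  by_cases hdep : ((a, b), k) ∈ deckDependent
  · have hmem := hdep
    rw [← map_fst_gainTable, List.mem_map] at hmem
    obtain ⟨x, hx, hxe⟩ := hmem
    obtain ⟨-, hf, hg⟩ := gainTable_spec x hx
    have hsgn := deckDependent_sign hd h x hx
    rw [hxe] at hsgn hf hg
    -- Player has drawn at all these states, so total 5 enters with the weight `pNum` rather than
    -- its complement.
    have hk : k.isSome = true := by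
      have : ∀ p ∈ deckDependent, p.2.isSome = true := by decide +kernel
      exact this _ hdep
    rw [eval_mixedGain, if_pos hk, CubDiff.eval_eq_of_equiv e hf, CubDiff.eval_eq_of_equiv e hg]
    exact hsgn
  · have hhand := (isHand_iff a b).2 hab
    have hok := handSignOK_all a b
    rw [handSignOK, hhand] at hok
    have hne : ((a, b), k) ≠ ((0, 6), none) := by
      intro h'
      obtain ⟨h1, rfl⟩ := Prod.mk.inj h'
      exact hi (Prod.ext (Subtype.ext h1) rfl)
    have hsign : signOK a b k = true := by
      simp only [Bool.not_true, Bool.false_or, Bool.and_eq_true, decide_eq_true_eq] at hok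
      cases k with
      | none => exact hok.1
      | some k => exact hok.2 k
    have hnm : decide (((a, b), k) ∈ ((0, 6), none) :: deckDependent) = false := by
      rw [decide_eq_false_iff_not, List.mem_cons, not_or]
      exact ⟨hne, hdep⟩
    rw [signOK, hnm, Bool.false_or] at hsign
    rw [tableDraws_eq_five d _ _ hdep]
    rw [SextDiff.eval]
    split_ifs with ht
    · rw [ht] at hsign
      have := Sext.eval_lt_of_lt e he hsign
      linarith
    · rw [Bool.not_eq_true] at ht
      rw [ht] at hsign
      have := Sext.eval_lt_of_lt e he hsign
      linarith

theorem mixedContribution_mixedInfo (hd : 1 ≤ d) :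
    mixedContribution d true 0 6 none = mixedContribution d false 0 6 none := by
  obtain ⟨e, h⟩ : ∃ e : ℝ, (d : ℝ) = e + 1 := ⟨d - 1, by ring⟩
  rw [← sub_eq_zero, mixedContribution_sub hd h, eval_mixedGain,
    CubDiff.eval_eq_of_equiv e fixedGain_mixed, CubDiff.eval_eq_of_equiv e freeGain_mixed]
  simp only [Option.isSome_none, Bool.false_eq_true, if_false, Cub.eval, CubDiff.eval, pNum, pDen]
  push_cast
  ring

theorem mixed_payoff (hd : 1 ≤ d) (T : Finset BankerInfo) :
    (pOpt d * baccaraPayoff d true T + (1 - pOpt d) * baccaraPayoff d false T) * sixDeals d =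
      ∑ i : BankerInfo, mixedContribution d (decide (i ∈ T)) i.1.1.1 i.1.1.2 i.2 := by
  rw [add_mul, mul_assoc, mul_assoc, baccaraPayoff_eq hd, baccaraPayoff_eq hd, Finset.mul_sum,
    Finset.mul_sum, ← Finset.sum_add_distrib]
  rfl

theorem mixed_payoff_bankerD (hd : 1 ≤ d) :
    pOpt d * baccaraPayoff d true (bankerD d) + (1 - pOpt d) * baccaraPayoff d false (bankerD d) =
    pOpt d * baccaraPayoff d true (bankerS d) +
      (1 - pOpt d) * baccaraPayoff d false (bankerS d) := by
  have h1 := payoff_bankerD hd true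
  have h0 := payoff_bankerD hd false
  have hm := mixedContribution_mixedInfo hd
  unfold mixedContribution at hm
  apply mul_right_cancel₀ (sixDeals_pos hd).ne'
  linear_combination pOpt d * h1 + (1 - pOpt d) * h0 + hm

theorem mixed_payoff_lt (hd : 1 ≤ d) (T : Finset BankerInfo) (hS : T ≠ bankerS d)
    (hD : T ≠ bankerD d) :
    pOpt d * baccaraPayoff d true (bankerS d) + (1 - pOpt d) * baccaraPayoff d false (bankerS d) <
      pOpt d * baccaraPayoff d true T + (1 - pOpt d) * baccaraPayoff d false T := by
  refine lt_of_mul_lt_mul_right ?_ (sixDeals_pos hd).le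
  rw [mixed_payoff hd, mixed_payoff hd]
  have key := sum_lt_sum_of_ne
    (fun (i : BankerInfo) act => mixedContribution d act i.1.1.1 i.1.1.2 i.2) (bankerS d) T
    mixedInfo mixedInfo_notMem (mixedContribution_mixedInfo hd)
  refine key (fun i hi => ?_) (fun i hi hne => ?_) hS hD
  · have ht : tableDraws d i.1.1 i.2 = true := by simpa [bankerS] using hi
    have := mixedContribution_sign hd i (by rintro rfl; exact mixedInfo_notMem hi)
    rwa [if_pos ht] at this
  · have ht : ¬ tableDraws d i.1.1 i.2 = true := by simpa [bankerS] using hi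
    have := mixedContribution_sign hd i hne
    rwa [if_neg ht] at this

end Optimality

/-! ### The equalizing probability of Banker and the value. -/

section Value

variable {d : ℕ}

/-- `sixDeals d` times the payoff for the table. -/
theorem payoff_bankerS_eq (hd : 1 ≤ d) (u : Bool) : baccaraPayoff d u (bankerS d) * sixDeals d =
    (fixedTotal.eval (d - 1) +
      if u = true then freeTotalDraw.eval (d - 1) else freeTotalStand.eval (d - 1)) +
    (gainTable.map fun x => if tableDraws d x.1.1 x.1.2 = true then
      x.2.1.eval (d - 1) * (x.2.2.1.eval (d - 1) +
        if u = x.1.2.isSome then x.2.2.2.eval (d - 1) else 0) else 0).sum := by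
  rw [payoff_bankerS hd, sum_contribution_table (show (d : ℝ) = (d - 1 : ℝ) + 1 by ring)]

theorem quadratic_pos (hd : 1 ≤ d) : (0 : ℝ) < 1408 * d ^ 2 - 220 * d + 9 := by
  have : (1 : ℝ) ≤ d := by exact_mod_cast hd
  nlinarith

/-- The two cases of `u` are two linear equations, which `qOpt d` and `vOpt d` solve. The formulas
change where some deck-dependent entry of the table switches: at d = 2, 3, 4, 8 and 10. -/
theorem equalizer (hd : 1 ≤ d) (u : Bool) :
    baccaraPayoff d u (bankerS d) * sixDeals d + qOpt d *
      (contribution d u true 0 6 none - contribution d u false 0 6 none) =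
    vOpt d * sixDeals d := by
  have hQ := (quadratic_pos hd).ne'
  have h5 := decks_sub_ne_zero hd (c := 5) (by norm_num)
  have hd0 : (d : ℝ) ≠ 0 := by positivity
  have hsix := (sixDeals_pos hd).ne'
  obtain ⟨t1, t2, t3, t4, t5, t6, t7, t8, t9⟩ := tableDraws_deckDependent d
  rw [payoff_bankerS_eq hd, gain_mixed (show (d : ℝ) = (d - 1 : ℝ) + 1 by ring)]
  rw [SextDiff.eval_eq_of_equiv _ fixedTotal_equiv, SextDiff.eval_eq_of_equiv _ freeTotalDraw_equiv,
    SextDiff.eval_eq_of_equiv _ freeTotalStand_equiv]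
  simp only [gainTable, List.map_cons, List.map_nil, List.sum_cons, List.sum_nil,
    t1, t2, t3, t4, t5, t6, t7, t8, t9, decide_eq_true_eq, Option.isSome_some]
  unfold qOpt vOpt
  dsimp only
  rw [← sixDeals_eq_descFactorial hd]
  by_cases c1 : d = 1
  · subst c1
    cases u <;> norm_num [sixDeals, Sext.eval, SextDiff.eval, Cub.eval, CubDiff.eval, pNum, pDen]
  by_cases c2 : d = 2
  · subst c2
    cases u <;> norm_num [sixDeals, Sext.eval, SextDiff.eval, Cub.eval, CubDiff.eval, pNum, pDen]
  by_cases c3 : d = 3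
  · subst c3
    cases u <;> norm_num [sixDeals, Sext.eval, SextDiff.eval, Cub.eval, CubDiff.eval, pNum, pDen]
  have b2 : ¬ d ≤ 2 := by omega
  have a2 : 2 ≤ d := by omega
  have a3 : 3 ≤ d := by omega
  have a4 : 4 ≤ d := by omega
  simp only [c1, c2, c3, b2, a2, a3, a4, if_true, if_false]
  have hv (N : ℝ) : -(32 * d * N / ((1408 * d ^ 2 - 220 * d + 9) * sixDeals d)) * sixDeals d =
      -(32 * d * N) / (1408 * d ^ 2 - 220 * d + 9) := by
    field_simp
  -- After `sixDeals d` cancels, the quadratic and 52d - 5 are treated as nonzero atoms. What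
  -- remains in each range of d is a polynomial identity.
  have clear_denominators {a q g N : ℝ} (h : a * (8 * d * (52 * d - 5) * (1408 * d ^ 2 - 220 * d + 9)) + q * g =
      -(32 * d * N) * (8 * d * (52 * d - 5))) :
      a + q / (8 * d * (52 * d - 5) * (1408 * d ^ 2 - 220 * d + 9)) * g =
        -(32 * d * N) / (1408 * d ^ 2 - 220 * d + 9) := by
    generalize (1408 * d ^ 2 - 220 * d + 9 : ℝ) = Q at *
    generalize (52 * d - 5 : ℝ) = L at *
    field_simp
    linarith
  by_cases c7 : d ≤ 7
  · have b8 : ¬ 8 ≤ d := by omega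
    have b10 : ¬ 10 ≤ d := by omega
    simp only [c7, b8, b10, if_true, if_false, hv, Sext.eval, SextDiff.eval, Cub.eval,
      CubDiff.eval, pNum, pDen]
    push_cast
    cases u <;>
    · simp only [Bool.false_eq_true, if_true, if_false]
      apply clear_denominators
      ring
  have a8 : 8 ≤ d := by omega
  by_cases c9 : d ≤ 9
  · have b10 : ¬ 10 ≤ d := by omega
    simp only [c7, c9, a8, b10, if_true, if_false, hv, Sext.eval, SextDiff.eval, Cub.eval,
      CubDiff.eval, pNum, pDen]
    push_cast
    cases u <;>
    · simp only [Bool.false_eq_true, if_true, if_false]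
      apply clear_denominators
      ring
  · have a10 : 10 ≤ d := by omega
    simp only [c7, c9, a8, a10, if_true, if_false, hv, Sext.eval, SextDiff.eval, Cub.eval,
      CubDiff.eval, pNum, pDen]
    push_cast
    cases u <;>
    · simp only [Bool.false_eq_true, if_true, if_false]
      apply clear_denominators
      ring

theorem pOpt_mem (hd : 1 ≤ d) : 0 < pOpt d ∧ pOpt d < 1 := by
  have h : (d : ℝ) = (d - 1 : ℝ) + 1 := by ring
  have he : (0 : ℝ) ≤ d - 1 := by
    have : (1 : ℝ) ≤ d := by exact_mod_cast hd
    linarith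
  have hD := pDen_eval_pos he
  have hN : 0 < pNum.eval (d - 1 : ℝ) := by
    unfold pNum Cub.eval; push_cast; positivity
  have hC : 0 < pNumCompl.eval (d - 1 : ℝ) := by
    unfold pNumCompl Cub.eval; push_cast; positivity
  rw [pNumCompl_eval] at hC
  rw [pOpt_eq hd h]
  exact ⟨div_pos hN hD, (div_lt_one hD).2 (by linarith)⟩

theorem qOpt_mem (hd : 1 ≤ d) : 0 < qOpt d ∧ qOpt d < 1 := by
  rcases Nat.lt_or_ge d 10 with h10 | h10
  · interval_cases d <;> norm_num [qOpt]
  · have c1 : d ≠ 1 := by omega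
    have c2 : d ≠ 2 := by omega
    have c3 : d ≠ 3 := by omega
    have c7 : ¬ d ≤ 7 := by omega
    have c9 : ¬ d ≤ 9 := by omega
    simp only [qOpt, c1, c2, c3, c7, c9, if_false]
    -- In powers of t = d - 10 the numerator, the denominator and their difference have positive
    -- coefficients.
    obtain ⟨t, rfl⟩ := Nat.exists_eq_add_of_le h10
    have ht : (0 : ℝ) ≤ t := Nat.cast_nonneg t
    push_cast
    have hden : (0 : ℝ) < 8 * (10 + t) * (52 * (10 + t) - 5) *
        (1408 * (10 + t) ^ 2 - 220 * (10 + t) + 9) := by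
      ring_nf; positivity
    refine ⟨div_pos ?_ hden, (div_lt_one hden).2 ?_⟩
    · ring_nf; positivity
    · rw [← sub_pos]; ring_nf; positivity

/-- The two gains differ by 4 `pDen` times the weight of the state. This is the nondegeneracy of the
2 × 2 kernel. -/
theorem gain_mixed_ne (hd : 1 ≤ d) :
    contribution d true true 0 6 none - contribution d true false 0 6 none ≠
      contribution d false true 0 6 none - contribution d false false 0 6 none := by
  have h : (d : ℝ) = (d - 1 : ℝ) + 1 := by ring
  have he : (0 : ℝ) ≤ d - 1 := by
    have : (1 : ℝ) ≤ d := by exact_mod_cast hd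
    linarith
  have hD := pDen_eval_pos he
  rw [gain_mixed h, gain_mixed h]
  set e : ℝ := d - 1
  have hw : 0 < 6016 + 18688 * e + 19328 * e ^ 2 + 6656 * e ^ 3 := by positivity
  simp only [if_true, Bool.false_eq_true, if_false]
  have := mul_pos hw hD
  intro h'
  linarith

end Value

theorem theorem4 (d : ℕ) (hd : 1 ≤ d) :
    (∀ x : Bool → ℝ, IsOptimalI (baccaraPayoff d) x ↔ x = playerMix (pOpt d)) ∧
    (∀ y : Finset BankerInfo → ℝ,
      IsOptimalII (baccaraPayoff d) y ↔ y = bankerMix d (qOpt d)) ∧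
    (0 < qOpt d ∧ qOpt d < 1) ∧
    IsGameValue (baccaraPayoff d) (vOpt d) := by
  obtain ⟨hp0, hp1⟩ := pOpt_mem hd
  obtain ⟨hq0, hq1⟩ := qOpt_mem hd
  have hsix := (sixDeals_pos hd).ne'
  have hq : ∀ u, (1 - qOpt d) * baccaraPayoff d u (bankerS d) +
      qOpt d * baccaraPayoff d u (bankerD d) = vOpt d := by
    intro u
    apply mul_right_cancel₀ hsix
    linear_combination equalizer hd u + qOpt d * payoff_bankerD hd u
  have hSD := mixed_payoff_bankerD hd
  -- Averaging the equalities `hq` with Player's weights gives v for the mixture of both players.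
  -- Since Player's mixture earns the same in both columns, each column yields v.
  have hS : pOpt d * baccaraPayoff d true (bankerS d) +
      (1 - pOpt d) * baccaraPayoff d false (bankerS d) = vOpt d := by
    linear_combination pOpt d * hq true + (1 - pOpt d) * hq false - qOpt d * hSD
  have hne : baccaraPayoff d true (bankerS d) - baccaraPayoff d false (bankerS d) ≠
      baccaraPayoff d true (bankerD d) - baccaraPayoff d false (bankerD d) := by
    intro h
    apply gain_mixed_ne hd
    linear_combination payoff_bankerD hd false - payoff_bankerD hd true - sixDeals d * h
  obtain ⟨h1, h2, h3⟩ := unique_optimal_of_equalizers hp0 hp1 hq0 hq1 hS (hSD.trans hS)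
    (fun T hTS hTD => hS ▸ mixed_payoff_lt hd T hTS hTD) hq hne
  exact ⟨h1, h2, ⟨hq0, hq1⟩, h3⟩
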